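/- Let $d\ge 1$, let $H^k(:,t,:)\in\mathbb{R}^{r\times r}$ ($k\in[d]$, $t\in[n]$) be the slices of the cores of a tensor ring and let $f(x)=\mathrm{Tr}(H^1[x_1]\cdots H^d[x_d])$, $x\in[n]^d$. For a set of $L$ cyclically consecutive sites, the segment $H$ is the product of its slices, viewed as a matrix $H_{[L];L+1,L+2}\in\mathbb{R}^{n^L\times r^2}$ (rows: outer indices; columns: the two latent indices). Let the ring be partitioned into four regions of consecutive sites in the cyclic order $c_1,a,c_2,b$, with lengths $L_{c_1},L_a,L_{c_2},L_b\ge\max(L_0,L_{\rm buffer})$. The condition number of a matrix $A$ is $\|A\|_2\|A^\dagger\|_2$, where $\dagger$ is the Moore–Penrose pseudo-inverse. Assume: (i) every segment of length $L$ with $L_0\le L\le d$ has rank $r^2$ and condition number at most $\kappa$; (ii) $0<\alpha\le 1$ and, if $L_a,L_b\ge L_{\rm buffer}$, then for every $z\in[n]^{L_a+L_b}$ the matrix $F_z\in\mathbb{R}^{n^{L_{c_1}}\times n^{L_{c_2}}}$, $F_z(x_{c_1},x_{c_2})=f(x)|_{x_{a\cup b}=z}$, satisfies $\|F_z\|_2^2\ge\alpha\|F_z\|_F^2$.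 Fix indices $z_b\in[n]^{L_b}$ in region $b$ such that the tensor $\hat T=f|_{x_b=z_b}$ is not zero. Let $B^2\in\mathbb{R}^{r\times r}$ be the product of the slices of region $b$ at $z_b$, let $p q^T$ be a best rank-one approximation of $B^2$ in the Frobenius norm, and let $\tilde H^{c_1},\tilde H^{c_2}$ be the matrices of size $r\times n^{L_{c_1}}$, $r\times n^{L_{c_2}}$ whose columns are $(q^TH^{c_1}[x_{c_1}])^T$ and $H^{c_2}[x_{c_2}]p$. Write $\hat T_{a;c_1c_2}$ and $\hat T_{c_2a;c_1}$ for the reshapings of $\hat T$, and let $\Pi_i$ ($i=1,2$) be the set of rank-$r$ orthogonal projections $XX^T$, $X^TX=I_r$, on $\mathbb{R}^{n^{L_{c_i}}}$. Let $P_1^*$ be any minimizer of $\|\hat T_{c_2a;c_1}P_1-\hat T_{c_2a;c_1}\|_F$ over $P_1\in\Pi_1$, let $P_2^*$ be any minimizer of $\|(\hat T_{a;c_1c_2}(I\otimes P_2)-\hat T_{a;c_1c_2})(P_1^*\otimes I)\|_F$ over $P_2\in\Pi_2$, and put $\hat{\hat T}=\hat T_{a;c_1c_2}(I\otimes P_2^*)(P_1^*\otimes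 I)$. Let $$\mathcal{E}=\frac{\|H^a-\hat{\hat T}\,(\tilde H^{c_1}\otimes\tilde H^{c_2})^\dagger\|_F^2}{\|H^a\|_F^2},$$ where $H^a$ is the $n^{L_a}\times r^2$ matrix of the segment of region $a$. 1. If $\frac1{\kappa^4}-2\sqrt r\sqrt{1-\frac{\alpha}{\kappa^4}}>0$, then $$\mathcal{E}\le\frac{(1+\sqrt2)^2\kappa^4\left(1-\frac{\alpha}{\kappa^4}\right)}{\frac1{\kappa^4}-2\sqrt r\sqrt{1-\frac{\alpha}{\kappa^4}}}.$$ 2. $\mathcal{E}=O(\delta\alpha+4\delta\kappa)$ for $\alpha=1-\delta\alpha$, $\kappa=1+\delta\kappa$ with small $\delta\alpha,\delta\kappa\ge0$: there is an absolute constant $C>0$ such that for every $r$ there is an $\varepsilon>0$ such that $\mathcal{E}\le C(\delta\alpha+4\delta\kappa)$ whenever $0\le\delta\alpha,\delta\kappa\le\varepsilon$ and the above assumptions hold with $\alpha=1-\delta\alpha$, $\kappa=1+\delta\kappa$ (for all $d$, $n$, all tensor rings of rank $r$ and all partitions). -/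

import Mathlib

open scoped Matrix Kronecker

noncomputable section

namespace TRStability

/-! ### Matrix notions -/

/-- The Frobenius norm of a real matrix. -/
def frobNorm {m k : Type*} [Fintype m] [Fintype k] (A : Matrix m k ℝ) : ℝ :=
  Real.sqrt (∑ i, ∑ j, A i j ^ 2)

section
open scoped Matrix.Norms.L2Operator

/-- The spectral norm (largest singular value) of a real matrix, i.e. the operator norm with
respect to the Euclidean norms. -/
def specNorm {m k : Type*} [Fintype m] [Fintype k] [DecidableEq k] (A : Matrix m k ℝ) : ℝ := ‖A‖

end

/-- The four Penrose equations: `X` is a Moore-Penrose pseudo-inverse of `A`. -/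
structure IsPseudoInverse {m k : Type*} [Fintype m] [Fintype k]
    (A : Matrix m k ℝ) (X : Matrix k m ℝ) : Prop where
  mul_mul_self : A * X * A = A
  self_mul_mul : X * A * X = X
  symm_left : (A * X)ᵀ = A * X
  symm_right : (X * A)ᵀ = X * A

theorem IsPseudoInverse.unique {m k : Type*} [Fintype m] [Fintype k]
    {A : Matrix m k ℝ} {X Y : Matrix k m ℝ} (hX : IsPseudoInverse A X)
    (hY : IsPseudoInverse A Y) : X = Y := by
  have h1 : A * X = A * Y := by
    calc A * X = (A * X)ᵀ := hX.symm_left.symm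
      _ = ((A * Y) * (A * X))ᵀ := by
          rw [← Matrix.mul_assoc, hY.mul_mul_self]
      _ = (A * X) * (A * Y) := by
          rw [Matrix.transpose_mul, hX.symm_left, hY.symm_left]
      _ = A * Y := by rw [← Matrix.mul_assoc, hX.mul_mul_self]
  have h2 : X * A = Y * A := by
    calc X * A = (X * A)ᵀ := hX.symm_right.symm
      _ = ((X * A) * (Y * A))ᵀ := by
          rw [Matrix.mul_assoc X A, ← Matrix.mul_assoc A Y A, hY.mul_mul_self]
      _ = (Y * A) * (X * A) := by
          rw [Matrix.transpose_mul, hX.symm_right, hY.symm_right]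
      _ = Y * A := by rw [Matrix.mul_assoc Y A, ← Matrix.mul_assoc A X A, hX.mul_mul_self]
  calc X = X * A * X := hX.self_mul_mul.symm
    _ = Y * A * Y := by rw [h2, Matrix.mul_assoc, h1, ← Matrix.mul_assoc]
    _ = Y := hY.self_mul_mul

theorem exists_isPseudoInverse {m k : Type*} [Fintype m] [Fintype k]
    (A : Matrix m k ℝ) : ∃ X : Matrix k m ℝ, IsPseudoInverse A X := by
  classical
  have hG : (Aᵀ * A).IsHermitian := by
    simp [Matrix.IsHermitian, Matrix.conjTranspose_eq_transpose_of_trivial]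
  obtain ⟨S, hS1, hS2, hS3, hS4⟩ : ∃ S : Matrix k k ℝ, (Aᵀ * A) * S * (Aᵀ * A) = Aᵀ * A ∧
      S * (Aᵀ * A) * S = S ∧ Sᵀ = S ∧ S * (Aᵀ * A) = (Aᵀ * A) * S := by
    set U : Matrix k k ℝ := (hG.eigenvectorUnitary : Matrix k k ℝ) with hU
    have hUU : Uᵀ * U = 1 := by
      have := Unitary.coe_star_mul_self hG.eigenvectorUnitary
      rwa [Matrix.star_eq_conjTranspose, Matrix.conjTranspose_eq_transpose_of_trivial] at this
    set D : Matrix k k ℝ := Matrix.diagonal hG.eigenvalues with hD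
    set D' : Matrix k k ℝ := Matrix.diagonal (fun i => (hG.eigenvalues i)⁻¹) with hD'
    have hspec : Aᵀ * A = U * D * Uᵀ := by
      have := hG.spectral_theorem
      rw [Unitary.conjStarAlgAut_apply, Matrix.star_eq_conjTranspose,
        Matrix.conjTranspose_eq_transpose_of_trivial] at this
      exact this
    have hc : ∀ X Y : Matrix k k ℝ, (U * X * Uᵀ) * (U * Y * Uᵀ) = U * (X * Y) * Uᵀ := by
      intro X Y
      calc (U * X * Uᵀ) * (U * Y * Uᵀ) = U * X * (Uᵀ * U) * Y * Uᵀ := by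
            simp only [Matrix.mul_assoc]
        _ = U * (X * Y) * Uᵀ := by rw [hUU]; simp only [Matrix.mul_assoc, Matrix.one_mul]
    refine ⟨U * D' * Uᵀ, ?_, ?_, ?_, ?_⟩
    · rw [hspec, hc, hc, hD, hD', Matrix.diagonal_mul_diagonal, Matrix.diagonal_mul_diagonal]
      congr 3
      ext i
      exact mul_inv_mul_cancel _
    · rw [hspec, hc, hc, hD, hD', Matrix.diagonal_mul_diagonal, Matrix.diagonal_mul_diagonal]
      congr 3
      ext i
      by_cases h : hG.eigenvalues i = 0
      · simp [h]
      · simp [h]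
    · simp [hD', Matrix.transpose_mul, Matrix.mul_assoc]
    · rw [hspec, hc, hc, hD, hD', Matrix.diagonal_mul_diagonal, Matrix.diagonal_mul_diagonal]
      congr 3
      ext i
      exact mul_comm _ _
  refine ⟨S * Aᵀ, ⟨?_, ?_, ?_, ?_⟩⟩
  · have h0 : (A * (S * Aᵀ) * A - A)ᵀ * (A * (S * Aᵀ) * A - A) = 0 := by
      have e1 : (A * (S * Aᵀ) * A - A)ᵀ = (Aᵀ * A) * S * Aᵀ - Aᵀ := by
        simp [Matrix.transpose_sub, Matrix.transpose_mul, hS3, Matrix.mul_assoc]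
      have e2 : Aᵀ * (A * (S * Aᵀ) * A - A) = 0 := by
        rw [Matrix.mul_sub, sub_eq_zero]
        simpa only [Matrix.mul_assoc] using hS1
      rw [e1, Matrix.sub_mul, e2, Matrix.mul_assoc _ Aᵀ, e2]
      simp
    rw [← Matrix.conjTranspose_eq_transpose_of_trivial,
      Matrix.conjTranspose_mul_self_eq_zero] at h0
    exact sub_eq_zero.mp h0
  · calc S * Aᵀ * A * (S * Aᵀ) = (S * (Aᵀ * A) * S) * Aᵀ := by simp only [Matrix.mul_assoc]
      _ = S * Aᵀ := by rw [hS2]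
  · simp [Matrix.transpose_mul, hS3, Matrix.mul_assoc]
  · rw [Matrix.mul_assoc, Matrix.transpose_mul, hS3, hS4]
    simp [Matrix.transpose_mul]

/-- The Moore-Penrose pseudo-inverse `A†`. -/
def pinv {m k : Type*} [Fintype m] [Fintype k] (A : Matrix m k ℝ) : Matrix k m ℝ :=
  (exists_isPseudoInverse A).choose

theorem pinv_spec {m k : Type*} [Fintype m] [Fintype k] (A : Matrix m k ℝ) :
    IsPseudoInverse A (pinv A) :=
  (exists_isPseudoInverse A).choose_spec

/-- The condition number `‖A‖₂ ‖A†‖₂`, i.e. the ratio of the largest to the smallest nonzero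
singular value. -/
def condNumber {m k : Type*} [Fintype m] [Fintype k] [DecidableEq m] [DecidableEq k]
    (A : Matrix m k ℝ) : ℝ :=
  specNorm A * specNorm (pinv A)

/-- `p qᵀ` is a best rank-one approximation of `B` (in the Frobenius norm). -/
def IsBestRankOne {m k : Type*} [Fintype m] [Fintype k] (B : Matrix m k ℝ)
    (p : m → ℝ) (q : k → ℝ) : Prop :=
  ∀ (u : m → ℝ) (v : k → ℝ),
    frobNorm (B - Matrix.vecMulVec p q) ≤ frobNorm (B - Matrix.vecMulVec u v)

/-- The orthogonal projections of rank `r`: `{X Xᵀ | Xᵀ X = 1, X has r columns}`. -/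
def rankProjections (m : Type*) [Fintype m] (r : ℕ) : Set (Matrix m m ℝ) :=
  {Y | ∃ X : Matrix m (Fin r) ℝ, Xᵀ * X = 1 ∧ Y = X * Xᵀ}

/-! ### Tensor rings, regions, segments -/

/-- The 3-tensors of a tensor ring: `H k t` is the slice `H^k(:, t, :)`. -/
abbrev Cores (d n r : ℕ) := Fin d → Fin n → Matrix (Fin r) (Fin r) ℝ

/-- The tensor `f(x) = Tr(H^1[x_1] ⋯ H^d[x_d])`. -/
def tensorRing {d n r : ℕ} (H : Cores d n r) (x : Fin d → Fin n) : ℝ :=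
  ((List.ofFn fun k => H k (x k)).prod).trace

/-- The product of the slices over the `L` cyclically consecutive sites
`s, s + 1, …, s + L - 1 (mod d)`. -/
def ringSegment {d n r : ℕ} [NeZero d] (H : Cores d n r) (s L : ℕ) (y : Fin L → Fin n) :
    Matrix (Fin r) (Fin r) ℝ :=
  (List.ofFn fun i : Fin L => H (Fin.ofNat d (s + i)) (y i)).prod

/-- The same segment reshaped to an `n^L × r²` matrix: the outer legs index the rows, the two
latent legs index the columns. -/
def segmentMatrix {d n r : ℕ} [NeZero d] (H : Cores d n r) (s L : ℕ) :
    Matrix (Fin L → Fin n) (Fin r × Fin r) ℝ :=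
  Matrix.of fun y jk => ringSegment H s L y jk.1 jk.2

/-- A partition of the ring into four consecutive regions, in the cyclic order
`c₁, a, c₂, b`; region `c₁` begins at site `start (mod d)`. -/
structure RingPartition (d : ℕ) where
  start : ℕ
  Lc₁ : ℕ
  La : ℕ
  Lc₂ : ℕ
  Lb : ℕ
  sum_eq : Lc₁ + La + Lc₂ + Lb = d

namespace RingPartition

variable {d : ℕ} (P : RingPartition d)

/-- The first site of region `a`. -/
def startA : ℕ := P.start + P.Lc₁

/-- The first site of region `c₂`. -/
def startC₂ : ℕ := P.start + P.Lc₁ + P.La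

/-- The first site of region `b`. -/
def startB : ℕ := P.start + P.Lc₁ + P.La + P.Lc₂

/-- The multi-index `x ∈ [n]^d` with the given restrictions to the four regions. -/
def glue [NeZero d] {n : ℕ} (y₁ : Fin P.Lc₁ → Fin n) (ya : Fin P.La → Fin n)
    (y₂ : Fin P.Lc₂ → Fin n) (yb : Fin P.Lb → Fin n) : Fin d → Fin n := fun k =>
  Fin.append (Fin.append (Fin.append y₁ ya) y₂) yb
    (Fin.cast P.sum_eq.symm (k - Fin.ofNat d P.start))

end RingPartition

/-- The matrix `f(Ω_z)_{c₁; a ∪ b ∪ c₂}` for `z = (za, zb)`: the indices in `a ∪ b` are frozen, so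
that its columns are indexed by the indices in `c₂`. -/
def frozenMatrix {d n : ℕ} [NeZero d] (f : (Fin d → Fin n) → ℝ) (P : RingPartition d)
    (za : Fin P.La → Fin n) (zb : Fin P.Lb → Fin n) :
    Matrix (Fin P.Lc₁ → Fin n) (Fin P.Lc₂ → Fin n) ℝ :=
  Matrix.of fun y₁ y₂ => f (P.glue y₁ za y₂ zb)

/-- Approximate Markovianity with parameter `α` and buffer length `Lbuf`. -/
def ApproxMarkov {d n : ℕ} [NeZero d] (f : (Fin d → Fin n) → ℝ) (P : RingPartition d)
    (Lbuf : ℕ) (α : ℝ) : Prop :=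
  Lbuf ≤ P.La → Lbuf ≤ P.Lb → ∀ (za : Fin P.La → Fin n) (zb : Fin P.Lb → Fin n),
    α * frobNorm (frozenMatrix f P za zb) ^ 2 ≤ specNorm (frozenMatrix f P za zb) ^ 2

/-- Non-degeneracy: every segment of length `L ≥ L₀`, as an `n^L × r²` matrix, has rank `r²` and
condition number at most `κ`. -/
def NondegenerateSegments {d n r : ℕ} [NeZero d] (H : Cores d n r) (L₀ : ℕ) (κ : ℝ) : Prop :=
  ∀ s L : ℕ, L₀ ≤ L → L ≤ d →
    (segmentMatrix H s L).rank = r ^ 2 ∧ condNumber (segmentMatrix H s L) ≤ κ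

/-! ### The initialization procedure applied to region `a` -/

/-- The 3-tensor `T̂`: the indices of `f` in region `b` are frozen to `zb`. -/
def hatT {d n : ℕ} [NeZero d] (f : (Fin d → Fin n) → ℝ) (P : RingPartition d)
    (zb : Fin P.Lb → Fin n) (ya : Fin P.La → Fin n) (y₁ : Fin P.Lc₁ → Fin n)
    (y₂ : Fin P.Lc₂ → Fin n) : ℝ :=
  f (P.glue y₁ ya y₂ zb)

/-- The reshaping `T̂_{a; c₁ c₂}`. -/
def hatTa {d n : ℕ} [NeZero d] (f : (Fin d → Fin n) → ℝ) (P : RingPartition d)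
    (zb : Fin P.Lb → Fin n) :
    Matrix (Fin P.La → Fin n) ((Fin P.Lc₁ → Fin n) × (Fin P.Lc₂ → Fin n)) ℝ :=
  Matrix.of fun ya y => hatT f P zb ya y.1 y.2

/-- The reshaping `T̂_{c₂ a; c₁}`. -/
def hatTc₁ {d n : ℕ} [NeZero d] (f : (Fin d → Fin n) → ℝ) (P : RingPartition d)
    (zb : Fin P.Lb → Fin n) :
    Matrix ((Fin P.Lc₂ → Fin n) × (Fin P.La → Fin n)) (Fin P.Lc₁ → Fin n) ℝ :=
  Matrix.of fun y y₁ => hatT f P zb y.2 y₁ y.1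

/-- `P₁ ⊗ I`, acting on the index of region `c₁`. -/
def onC₁ {d n : ℕ} (P : RingPartition d)
    (P₁ : Matrix (Fin P.Lc₁ → Fin n) (Fin P.Lc₁ → Fin n) ℝ) :
    Matrix ((Fin P.Lc₁ → Fin n) × (Fin P.Lc₂ → Fin n))
      ((Fin P.Lc₁ → Fin n) × (Fin P.Lc₂ → Fin n)) ℝ :=
  P₁ ⊗ₖ (1 : Matrix (Fin P.Lc₂ → Fin n) (Fin P.Lc₂ → Fin n) ℝ)

/-- `I ⊗ P₂`, acting on the index of region `c₂`. -/
def onC₂ {d n : ℕ} (P : RingPartition d)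
    (P₂ : Matrix (Fin P.Lc₂ → Fin n) (Fin P.Lc₂ → Fin n) ℝ) :
    Matrix ((Fin P.Lc₁ → Fin n) × (Fin P.Lc₂ → Fin n))
      ((Fin P.Lc₁ → Fin n) × (Fin P.Lc₂ → Fin n)) ℝ :=
  (1 : Matrix (Fin P.Lc₁ → Fin n) (Fin P.Lc₁ → Fin n) ℝ) ⊗ₖ P₂

/-- `P₁` is a best rank-`r` projection for `T̂_{c₂ a; c₁}`. -/
def IsOptimalP₁ {d n : ℕ} [NeZero d] (f : (Fin d → Fin n) → ℝ) (P : RingPartition d)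
    (zb : Fin P.Lb → Fin n) (r : ℕ)
    (P₁ : Matrix (Fin P.Lc₁ → Fin n) (Fin P.Lc₁ → Fin n) ℝ) : Prop :=
  P₁ ∈ rankProjections (Fin P.Lc₁ → Fin n) r ∧
    ∀ Q ∈ rankProjections (Fin P.Lc₁ → Fin n) r,
      frobNorm (hatTc₁ f P zb * P₁ - hatTc₁ f P zb) ≤ frobNorm (hatTc₁ f P zb * Q - hatTc₁ f P zb)

/-- Given `P₁`, the projection `P₂` minimizes `‖(T̂_{a; c₁ c₂} (I ⊗ P₂) - T̂_{a; c₁ c₂}) (P₁ ⊗ I)‖_F`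
over the rank-`r` projections. -/
def IsOptimalP₂ {d n : ℕ} [NeZero d] (f : (Fin d → Fin n) → ℝ) (P : RingPartition d)
    (zb : Fin P.Lb → Fin n) (r : ℕ)
    (P₁ : Matrix (Fin P.Lc₁ → Fin n) (Fin P.Lc₁ → Fin n) ℝ)
    (P₂ : Matrix (Fin P.Lc₂ → Fin n) (Fin P.Lc₂ → Fin n) ℝ) : Prop :=
  P₂ ∈ rankProjections (Fin P.Lc₂ → Fin n) r ∧
    ∀ Q ∈ rankProjections (Fin P.Lc₂ → Fin n) r,
      frobNorm ((hatTa f P zb * onC₂ P P₂ - hatTa f P zb) * onC₁ P P₁) ≤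
        frobNorm ((hatTa f P zb * onC₂ P Q - hatTa f P zb) * onC₁ P P₁)

/-- The doubly projected tensor `T̂_{a; c₁ c₂} (I ⊗ P₂) (P₁ ⊗ I)`. -/
def projT {d n : ℕ} [NeZero d] (f : (Fin d → Fin n) → ℝ) (P : RingPartition d)
    (zb : Fin P.Lb → Fin n)
    (P₁ : Matrix (Fin P.Lc₁ → Fin n) (Fin P.Lc₁ → Fin n) ℝ)
    (P₂ : Matrix (Fin P.Lc₂ → Fin n) (Fin P.Lc₂ → Fin n) ℝ) :
    Matrix (Fin P.La → Fin n) ((Fin P.Lc₁ → Fin n) × (Fin P.Lc₂ → Fin n)) ℝ :=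
  hatTa f P zb * onC₂ P P₂ * onC₁ P P₁

/-- The matrix `B²`: the segment of region `b` with its outer legs frozen to `zb`. -/
def B₂ {d n r : ℕ} [NeZero d] (H : Cores d n r) (P : RingPartition d)
    (zb : Fin P.Lb → Fin n) : Matrix (Fin r) (Fin r) ℝ :=
  ringSegment H P.startB P.Lb zb

/-- `H̃^{c₁}`: the segment of region `c₁` with `q` attached to the leg that pointed to region `b`,
as an `r × n^{L_{c₁}}` matrix. -/
def tildeHc₁ {d n r : ℕ} [NeZero d] (H : Cores d n r) (P : RingPartition d) (q : Fin r → ℝ) :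
    Matrix (Fin r) (Fin P.Lc₁ → Fin n) ℝ :=
  Matrix.of fun j y => (q ᵥ* ringSegment H P.start P.Lc₁ y) j

/-- `H̃^{c₂}`: the segment of region `c₂` with `p` attached to the leg that pointed to region `b`,
as an `r × n^{L_{c₂}}` matrix. -/
def tildeHc₂ {d n r : ℕ} [NeZero d] (H : Cores d n r) (P : RingPartition d) (p : Fin r → ℝ) :
    Matrix (Fin r) (Fin P.Lc₂ → Fin n) ℝ :=
  Matrix.of fun k y => (ringSegment H P.startC₂ P.Lc₂ y *ᵥ p) k

/-- `H^a_{[L_a]; L_a+1, L_a+2}`, the true segment of region `a`. -/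
def segA {d n r : ℕ} [NeZero d] (H : Cores d n r) (P : RingPartition d) :
    Matrix (Fin P.La → Fin n) (Fin r × Fin r) ℝ :=
  segmentMatrix H P.startA P.La

/-- The recovered segment of region `a`: the doubly projected tensor times
`(H̃^{c₁} ⊗ H̃^{c₂})†`. -/
def recoveredA {d n r : ℕ} [NeZero d] (H : Cores d n r) (P : RingPartition d)
    (zb : Fin P.Lb → Fin n) (p q : Fin r → ℝ)
    (P₁ : Matrix (Fin P.Lc₁ → Fin n) (Fin P.Lc₁ → Fin n) ℝ)
    (P₂ : Matrix (Fin P.Lc₂ → Fin n) (Fin P.Lc₂ → Fin n) ℝ) :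
    Matrix (Fin P.La → Fin n) (Fin r × Fin r) ℝ :=
  projT (tensorRing H) P zb P₁ P₂ * pinv (tildeHc₁ H P q ⊗ₖ tildeHc₂ H P p)

end TRStability

end

/-!
Everything is a statement about the contraction `Φ(A, B) = M₁ K(A, B) M₂ᵀ` of a ring of four
matrices, where `M₁`, `M₂` are the segment matrices of `c₁`, `c₂` and the coupling `K(A, B)` of
their latent legs satisfies `‖K(A, B)‖_F = ‖A‖_F ‖B‖_F` and `‖K(A, B)‖₂ ≤ ‖A‖_F ‖B‖₂`. Slicing `T̂`
over region `a` gives `Φ(Hᵃ[yₐ], B²)`. Since `M₁`, `M₂` have full column rank, `Φ` is bounded above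
and below in Frobenius norm, with ratio at most `κ²`
(`frobNorm_ringContraction_le`, `frobNorm_mul_le_ringContraction`).

* Approximate Markovianity for a nonzero slice of region `a` yields `α ‖B²‖_F² ≤ κ⁴ σ²`, where
  `σ = ‖p qᵀ‖_F` (`frobNorm_B₂_sq_le`). As `‖B² - p qᵀ‖_F² = ‖B²‖_F² - σ²`
  (`IsBestRankOne.residual_sq`), the relative rank-one error of `B²` is at most `κ⁴ / α - 1`.
* Let `G = H̃^{c₁} ⊗ H̃^{c₂}` and `T = Hᵃ G`, the tensor with `p qᵀ` in place of `B²`. The rows of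
  `W G` are the contractions `Φ(W_i, p qᵀ)`, so `G` is bounded below, `G G† = 1`, and
  multiplication by `G†` costs at most `‖M₁†‖₂ ‖M₂†‖₂ / σ` (`frobNorm_mul_pinv_le`).
* `T` is fixed by the orthogonal projections onto the row spaces of `H̃^{c₁}` and `H̃^{c₂}`, which
  compete with `P₁*` and `P₂*`; hence `‖T̂ - T̂̂‖_F ≤ √2 ‖T̂ - T‖_F`
  (`frobNorm_sub_two_truncations_le`).

Together, `Hᵃ - T̂̂ G† = (T - T̂̂) G†` gives `ℰ ≤ (1 + √2)² κ⁴ (κ⁴ / α - 1)` (`recovery_error_le`).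
This is at most the first bound, because `1 / κ⁴ - 2 √r √(1 - α / κ⁴) ≤ α / κ⁴`, and it is linear in
`δα`, `δκ` to first order, uniformly in `r`.
-/

namespace TRStability

/-! ### Frobenius and spectral norms -/

section Norms

variable {l m k : Type*} [Fintype l] [Fintype m] [Fintype k]

theorem frobNorm_nonneg (A : Matrix m k ℝ) : 0 ≤ frobNorm A := Real.sqrt_nonneg _

theorem frobNorm_sq (A : Matrix m k ℝ) : frobNorm A ^ 2 = ∑ i, ∑ j, A i j ^ 2 :=
  Real.sq_sqrt (Finset.sum_nonneg fun _ _ => Finset.sum_nonneg fun _ _ => sq_nonneg _)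

section
open scoped Matrix.Norms.Frobenius

theorem frobNorm_eq_norm (A : Matrix m k ℝ) : frobNorm A = ‖A‖ := by
  rw [Matrix.frobenius_norm_def, frobNorm, Real.sqrt_eq_rpow]
  simp

theorem frobNorm_add_le (A B : Matrix m k ℝ) : frobNorm (A + B) ≤ frobNorm A + frobNorm B := by
  simpa only [frobNorm_eq_norm] using norm_add_le A B

theorem frobNorm_sub_rev (A B : Matrix m k ℝ) : frobNorm (A - B) = frobNorm (B - A) := by
  simpa only [frobNorm_eq_norm] using norm_sub_rev A B

theorem frobNorm_eq_zero {A : Matrix m k ℝ} : frobNorm A = 0 ↔ A = 0 := by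
  rw [frobNorm_eq_norm, norm_eq_zero]

theorem frobNorm_zero : frobNorm (0 : Matrix m k ℝ) = 0 := frobNorm_eq_zero.mpr rfl

theorem frobNorm_transpose (A : Matrix m k ℝ) : frobNorm Aᵀ = frobNorm A := by
  simp only [frobNorm_eq_norm, Matrix.frobenius_norm_transpose]

theorem frobNorm_mul_le (A : Matrix l m ℝ) (B : Matrix m k ℝ) :
    frobNorm (A * B) ≤ frobNorm A * frobNorm B := by
  simpa only [frobNorm_eq_norm] using Matrix.frobenius_norm_mul A B

end

theorem frobNorm_vecMulVec_sq (u : m → ℝ) (v : k → ℝ) :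
    frobNorm (Matrix.vecMulVec u v) ^ 2 = (∑ i, u i ^ 2) * ∑ j, v j ^ 2 := by
  simp only [frobNorm_sq, Matrix.vecMulVec_apply, mul_pow, Finset.sum_mul_sum]

section
open scoped Matrix.Norms.L2Operator

theorem specNorm_nonneg [DecidableEq k] (A : Matrix m k ℝ) : 0 ≤ specNorm A := norm_nonneg _

theorem sum_sq_mulVec_le [DecidableEq k] (A : Matrix m k ℝ) (v : k → ℝ) :
    ∑ i, (A *ᵥ v) i ^ 2 ≤ specNorm A ^ 2 * ∑ j, v j ^ 2 := by
  have h := Matrix.l2_opNorm_mulVec A (WithLp.toLp 2 v)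
  have h2 := pow_le_pow_left₀ (norm_nonneg _) h 2
  rw [mul_pow, EuclideanSpace.real_norm_sq_eq, EuclideanSpace.real_norm_sq_eq] at h2
  exact h2

theorem specNorm_le_of_forall [DecidableEq k] (A : Matrix m k ℝ) {c : ℝ} (hc : 0 ≤ c)
    (h : ∀ v : k → ℝ, ∑ i, (A *ᵥ v) i ^ 2 ≤ c ^ 2 * ∑ j, v j ^ 2) : specNorm A ≤ c := by
  rw [specNorm, Matrix.l2_opNorm_def]
  refine ContinuousLinearMap.opNorm_le_bound _ hc fun v => ?_
  refine le_of_sq_le_sq ?_ (by positivity)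
  rw [mul_pow, EuclideanSpace.real_norm_sq_eq, EuclideanSpace.real_norm_sq_eq]
  exact h v.ofLp

theorem specNorm_transpose [DecidableEq m] [DecidableEq k] (A : Matrix m k ℝ) :
    specNorm Aᵀ = specNorm A := by
  rw [← Matrix.conjTranspose_eq_transpose_of_trivial]
  exact Matrix.l2_opNorm_conjTranspose A

theorem specNorm_mul_le [DecidableEq m] [DecidableEq k] (A : Matrix l m ℝ) (B : Matrix m k ℝ) :
    specNorm (A * B) ≤ specNorm A * specNorm B :=
  Matrix.l2_opNorm_mul A B

theorem specNorm_pos [DecidableEq k] {A : Matrix m k ℝ} (hA : A ≠ 0) : 0 < specNorm A :=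
  norm_pos_iff.mpr hA

end

theorem frobNorm_mul_le_specNorm_mul [DecidableEq m] (A : Matrix l m ℝ) (B : Matrix m k ℝ) :
    frobNorm (A * B) ≤ specNorm A * frobNorm B := by
  refine le_of_sq_le_sq ?_ (mul_nonneg (specNorm_nonneg A) (frobNorm_nonneg B))
  rw [mul_pow, frobNorm_sq, frobNorm_sq, Finset.sum_comm,
    Finset.sum_comm (f := fun i j => B i j ^ 2), Finset.mul_sum]
  exact Finset.sum_le_sum fun j _ => sum_sq_mulVec_le A fun i => B i j

theorem frobNorm_mul_le_mul_specNorm [DecidableEq m] [DecidableEq k] (A : Matrix l m ℝ)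
    (B : Matrix m k ℝ) : frobNorm (A * B) ≤ frobNorm A * specNorm B := by
  rw [← frobNorm_transpose (A * B), Matrix.transpose_mul, mul_comm (frobNorm A),
    ← frobNorm_transpose A, ← specNorm_transpose B]
  exact frobNorm_mul_le_specNorm_mul _ _

/-- A nonzero matrix has condition number at least one. -/
theorem one_le_condNumber [DecidableEq m] [DecidableEq k] {A : Matrix m k ℝ} (hA : A ≠ 0) :
    1 ≤ condNumber A := by
  have h := specNorm_mul_le (A * pinv A) A
  rw [(pinv_spec A).mul_mul_self] at h
  have h2 := mul_le_mul_of_nonneg_right (specNorm_mul_le A (pinv A)) (specNorm_nonneg A)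
  have h3 := specNorm_pos hA
  rw [condNumber]
  nlinarith

theorem pinv_mul_of_rank_eq_card [DecidableEq k] {A : Matrix m k ℝ}
    (hA : A.rank = Fintype.card k) : pinv A * A = 1 := by
  have hinj : Function.Injective A.mulVec := by
    rw [Matrix.mulVec_injective_iff, linearIndependent_iff_card_eq_finrank_span, Set.finrank,
      ← Matrix.rank_eq_finrank_span_cols, hA]
  have h : A * (pinv A * A) = A * (1 : Matrix k k ℝ) := by
    rw [← Matrix.mul_assoc, (pinv_spec A).mul_mul_self, Matrix.mul_one]
  ext i j
  have h2 : (pinv A * A).col j = (1 : Matrix k k ℝ).col j := by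
    apply hinj
    ext i
    exact congrFun (congrFun h i) j
  exact congrFun h2 i

/-- Pythagoras for the splitting of the row space by an orthogonal projection `Q`. -/
theorem frobNorm_sq_add_of_projection [DecidableEq k] (X Y : Matrix m k ℝ) {Q : Matrix k k ℝ}
    (hQt : Qᵀ = Q) (hQ : Q * Q = Q) :
    frobNorm (X * (1 - Q) + Y * Q) ^ 2 = frobNorm (X * (1 - Q)) ^ 2 + frobNorm (Y * Q) ^ 2 := by
  have key : ∀ A : Matrix m k ℝ, frobNorm A ^ 2 = (A * Aᵀ).trace := by
    intro A
    rw [frobNorm_sq]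
    simp only [Matrix.trace, Matrix.diag, Matrix.mul_apply, Matrix.transpose_apply, sq]
  have h1 : (1 - Q) * Q = 0 := by rw [Matrix.sub_mul, hQ, Matrix.one_mul, sub_self]
  have h2 : Q * (1 - Q) = 0 := by rw [Matrix.mul_sub, hQ, Matrix.mul_one, sub_self]
  have h3 : X * (1 - Q) * (Y * Q)ᵀ = 0 := by
    rw [Matrix.transpose_mul, hQt, Matrix.mul_assoc, ← Matrix.mul_assoc (1 - Q), h1,
      Matrix.zero_mul, Matrix.mul_zero]
  have h4 : Y * Q * (X * (1 - Q))ᵀ = 0 := by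
    rw [Matrix.transpose_mul, Matrix.transpose_sub, Matrix.transpose_one, hQt, Matrix.mul_assoc,
      ← Matrix.mul_assoc Q, h2, Matrix.zero_mul, Matrix.mul_zero]
  rw [key, key, key, Matrix.transpose_add, Matrix.add_mul, Matrix.mul_add, Matrix.mul_add, h3, h4,
    add_zero, zero_add, Matrix.trace_add]

theorem frobNorm_mul_projection_le [DecidableEq k] (X : Matrix m k ℝ) {Q : Matrix k k ℝ}
    (hQt : Qᵀ = Q) (hQ : Q * Q = Q) : frobNorm (X * Q) ≤ frobNorm X := by
  have h := frobNorm_sq_add_of_projection X X hQt hQ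
  rw [← Matrix.mul_add, sub_add_cancel, Matrix.mul_one] at h
  exact le_of_sq_le_sq (by nlinarith [sq_nonneg (frobNorm (X * (1 - Q)))]) (frobNorm_nonneg X)

theorem frobNorm_mul_one_sub_projection_le [DecidableEq k] (X : Matrix m k ℝ) {Q : Matrix k k ℝ}
    (hQt : Qᵀ = Q) (hQ : Q * Q = Q) : frobNorm (X * (1 - Q)) ≤ frobNorm X := by
  have h := frobNorm_sq_add_of_projection X X hQt hQ
  rw [← Matrix.mul_add, sub_add_cancel, Matrix.mul_one] at h
  exact le_of_sq_le_sq (by nlinarith [sq_nonneg (frobNorm (X * Q))]) (frobNorm_nonneg X)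

/-- A matrix `G` that is bounded below as a right multiplication is right invertible, with
`pinv G` as a right inverse. -/
theorem mul_pinv_of_antilipschitz [DecidableEq m] {G : Matrix m k ℝ} {c : ℝ}
    (hG : ∀ W : Matrix m m ℝ, frobNorm W ≤ c * frobNorm (W * G)) : G * pinv G = 1 := by
  have h := hG (G * pinv G - 1)
  rw [Matrix.sub_mul, (pinv_spec G).mul_mul_self, Matrix.one_mul, sub_self, frobNorm_zero,
    mul_zero] at h
  exact sub_eq_zero.mp (frobNorm_eq_zero.mp (le_antisymm h (frobNorm_nonneg _)))

/-- A lower bound for right multiplication by `G` is an upper bound for that by `pinv G`, because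
`pinv G * G` is an orthogonal projection. -/
theorem frobNorm_mul_pinv_le [DecidableEq k] {G : Matrix m k ℝ} {c : ℝ} (hc : 0 ≤ c)
    (hG : ∀ W : Matrix l m ℝ, frobNorm W ≤ c * frobNorm (W * G)) (X : Matrix l k ℝ) :
    frobNorm (X * pinv G) ≤ c * frobNorm X := by
  refine (hG _).trans (mul_le_mul_of_nonneg_left ?_ hc)
  rw [Matrix.mul_assoc]
  refine frobNorm_mul_projection_le X (pinv_spec G).symm_right ?_
  rw [← Matrix.mul_assoc, (pinv_spec G).self_mul_mul]

end Norms

/-! ### Best rank-one approximations -/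

section RankOne

variable {m k : Type*} [Fintype m] [Fintype k]

theorem frobNorm_sub_vecMulVec_sq (B : Matrix m k ℝ) (u : m → ℝ) (v : k → ℝ) :
    frobNorm (B - Matrix.vecMulVec u v) ^ 2 =
      frobNorm B ^ 2 - 2 * (u ⬝ᵥ B *ᵥ v) + (∑ i, u i ^ 2) * ∑ j, v j ^ 2 := by
  rw [← frobNorm_vecMulVec_sq, frobNorm_sq, frobNorm_sq, frobNorm_sq]
  simp only [dotProduct, Matrix.mulVec, Matrix.sub_apply, Matrix.vecMulVec_apply, Finset.mul_sum,
    ← Finset.sum_sub_distrib, ← Finset.sum_add_distrib]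
  refine Finset.sum_congr rfl fun i _ => Finset.sum_congr rfl fun j _ => ?_
  ring

/-- The residual of a best rank-one approximation `p qᵀ` is orthogonal to `p qᵀ`. -/
theorem IsBestRankOne.residual_sq {B : Matrix m k ℝ} {p : m → ℝ} {q : k → ℝ}
    (h : IsBestRankOne B p q) :
    frobNorm (B - Matrix.vecMulVec p q) ^ 2 =
      frobNorm B ^ 2 - (∑ i, p i ^ 2) * ∑ j, q j ^ 2 := by
  set s := (∑ i, p i ^ 2) * ∑ j, q j ^ 2 with hs
  set g := p ⬝ᵥ B *ᵥ q with hg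
  have hs0 : 0 ≤ s := by positivity
  -- Compare with the multiples `t • p qᵀ`.
  have ht : ∀ t : ℝ, -2 * g + s ≤ -2 * t * g + t ^ 2 * s := by
    intro t
    have h1 := pow_le_pow_left₀ (frobNorm_nonneg _) (h (t • p) q) 2
    rw [frobNorm_sub_vecMulVec_sq, frobNorm_sub_vecMulVec_sq, smul_dotProduct, smul_eq_mul] at h1
    have h2 : (∑ i, (t • p) i ^ 2) * ∑ j, q j ^ 2 = t ^ 2 * s := by
      simp only [Pi.smul_apply, smul_eq_mul, mul_pow, ← Finset.mul_sum, hs, mul_assoc]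
    rw [h2, ← hs, ← hg] at h1
    linarith
  have hgs : g = s := by
    rcases hs0.eq_or_lt with h0 | h0
    · have h1 := ht 2
      have h2 := ht 0
      rw [← h0] at h1 h2 ⊢
      linarith
    · have h1 := ht (g / s)
      have h2 : -2 * (g / s) * g + (g / s) ^ 2 * s = -(g ^ 2 / s) := by
        field_simp
        ring
      rw [h2] at h1
      have h3 : (g - s) ^ 2 / s = g ^ 2 / s + (-2 * g + s) := by
        field_simp
        ring
      have h4 : 0 ≤ (g - s) ^ 2 / s := by positivity
      have h5 : (g - s) ^ 2 / s = 0 := by linarith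
      have h6 : (g - s) ^ 2 = 0 := by
        rcases div_eq_zero_iff.mp h5 with h | h
        · exact h
        · exact absurd h h0.ne'
      exact sub_eq_zero.mp (pow_eq_zero_iff two_ne_zero |>.mp h6)
  rw [frobNorm_sub_vecMulVec_sq, ← hs, ← hg, hgs]
  ring

/-- The norm of a best rank-one approximation of `B` dominates the spectral norm of `B`. -/
theorem IsBestRankOne.specNorm_sq_le [DecidableEq k] {B : Matrix m k ℝ} {p : m → ℝ} {q : k → ℝ}
    (h : IsBestRankOne B p q) :
    specNorm B ^ 2 ≤ (∑ i, p i ^ 2) * ∑ j, q j ^ 2 := by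
  set s := (∑ i, p i ^ 2) * ∑ j, q j ^ 2 with hs
  have hs0 : 0 ≤ s := by positivity
  have h1 : specNorm B ≤ Real.sqrt s := by
    refine specNorm_le_of_forall B (Real.sqrt_nonneg s) fun v => ?_
    rw [Real.sq_sqrt hs0]
    set N := ∑ j, v j ^ 2 with hN
    have hN0 : 0 ≤ N := by positivity
    rcases hN0.eq_or_lt with h0 | h0
    · have hv : v = 0 := by
        ext j
        have := (Finset.sum_eq_zero_iff_of_nonneg (fun j _ => sq_nonneg (v j))).mp h0.symm j
          (Finset.mem_univ j)
        simpa using this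
      simp [hv, hN]
    · -- Compare with `B v vᵀ / ‖v‖²`, the projection of `B` to the direction `v`.
      have h2 := pow_le_pow_left₀ (frobNorm_nonneg _) (h (N⁻¹ • B *ᵥ v) v) 2
      rw [h.residual_sq, frobNorm_sub_vecMulVec_sq, ← hs, ← hN, smul_dotProduct, smul_eq_mul] at h2
      have h3 : (∑ i, (N⁻¹ • B *ᵥ v) i ^ 2) * N = N⁻¹ * ∑ i, (B *ᵥ v) i ^ 2 := by
        simp only [Pi.smul_apply, smul_eq_mul, mul_pow, ← Finset.mul_sum]
        field_simp
      have h4 : (B *ᵥ v) ⬝ᵥ (B *ᵥ v) = ∑ i, (B *ᵥ v) i ^ 2 := by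
        simp only [dotProduct, sq]
      rw [h3, h4] at h2
      have h5 : N⁻¹ * ∑ i, (B *ᵥ v) i ^ 2 ≤ s := by linarith
      rwa [inv_mul_le_iff₀ h0, mul_comm] at h5
  calc specNorm B ^ 2 ≤ Real.sqrt s ^ 2 := pow_le_pow_left₀ (specNorm_nonneg B) h1 2
    _ = s := Real.sq_sqrt hs0

end RankOne

/-! ### Contracting a ring of four matrices -/

section Contraction

variable {R Y₁ Y₂ : Type*} [Fintype R]

/-- The coupling of the two latent legs of region `c₁` (rows `(i, j)`) to those of region `c₂`
(columns `(k, l)`) when the matrices `A` and `B` sit on the two arcs between these regions: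
`j` is joined to `k` through `A` and `l` to `i` through `B`. -/
def couplingMatrix (A B : Matrix R R ℝ) : Matrix (R × R) (R × R) ℝ :=
  Matrix.of fun ij kl => A ij.2 kl.1 * B kl.2 ij.1

/-- The ring closed from two segments `M₁`, `M₂` with open outer legs and the matrices `A` and `B`
between them, in the cyclic order `M₁, A, M₂, B`. -/
def ringContraction (M₁ : Matrix Y₁ (R × R) ℝ) (M₂ : Matrix Y₂ (R × R) ℝ) (A B : Matrix R R ℝ) :
    Matrix Y₁ Y₂ ℝ :=
  M₁ * couplingMatrix A B * M₂ᵀ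

theorem ringContraction_apply_eq_trace (M₁ : Matrix Y₁ (R × R) ℝ) (M₂ : Matrix Y₂ (R × R) ℝ)
    (A B : Matrix R R ℝ) (y₁ : Y₁) (y₂ : Y₂) :
    ringContraction M₁ M₂ A B y₁ y₂ =
      ((Matrix.of fun i j => M₁ y₁ (i, j)) * A * (Matrix.of fun k l => M₂ y₂ (k, l)) * B).trace := by
  simp only [ringContraction, couplingMatrix, Matrix.mul_apply, Matrix.trace, Matrix.diag,
    Matrix.of_apply, Matrix.transpose_apply, Fintype.sum_prod_type, Finset.sum_mul]
  have e : ∀ g : R → R → R → R → ℝ, ∑ k, ∑ l, ∑ i, ∑ j, g i j k l =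
      ∑ i, ∑ l, ∑ k, ∑ j, g i j k l := by
    intro g
    rw [Finset.sum_comm]
    calc ∑ l, ∑ k, ∑ i, ∑ j, g i j k l = ∑ l, ∑ i, ∑ k, ∑ j, g i j k l :=
          Finset.sum_congr rfl fun l _ => Finset.sum_comm
      _ = _ := Finset.sum_comm
  rw [e]
  refine Finset.sum_congr rfl fun i _ => Finset.sum_congr rfl fun l _ =>
    Finset.sum_congr rfl fun k _ => Finset.sum_congr rfl fun j _ => ?_
  ring

theorem ringContraction_sub_right (M₁ : Matrix Y₁ (R × R) ℝ) (M₂ : Matrix Y₂ (R × R) ℝ)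
    (A B B' : Matrix R R ℝ) :
    ringContraction M₁ M₂ A (B - B') = ringContraction M₁ M₂ A B - ringContraction M₁ M₂ A B' := by
  have h : couplingMatrix A (B - B') = couplingMatrix A B - couplingMatrix A B' := by
    ext
    simp [couplingMatrix, mul_sub]
  rw [ringContraction, h, Matrix.mul_sub, Matrix.sub_mul]
  rfl

theorem frobNorm_couplingMatrix (A B : Matrix R R ℝ) :
    frobNorm (couplingMatrix A B) = frobNorm A * frobNorm B := by
  have h : frobNorm (couplingMatrix A B) ^ 2 = (frobNorm A * frobNorm B) ^ 2 := by
    rw [mul_pow]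
    simp only [frobNorm_sq, couplingMatrix, Matrix.of_apply, Fintype.sum_prod_type, mul_pow]
    calc ∑ i, ∑ j, ∑ k, ∑ l, A j k ^ 2 * B l i ^ 2
        = ∑ i, ∑ j, (∑ k, A j k ^ 2) * ∑ l, B l i ^ 2 := by
          simp only [Finset.sum_mul_sum]
      _ = (∑ j, ∑ k, A j k ^ 2) * ∑ i, ∑ l, B l i ^ 2 := by
          rw [Finset.sum_comm, Finset.sum_mul_sum]
      _ = _ := by rw [Finset.sum_comm (f := fun i l => B l i ^ 2)]
  exact (sq_eq_sq₀ (frobNorm_nonneg _)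
    (mul_nonneg (frobNorm_nonneg _) (frobNorm_nonneg _))).mp h

variable [DecidableEq R]

/-- On `X ∈ ℝ^{R × R}` the coupling acts by `X ↦ (A X B)ᵀ`. -/
theorem specNorm_couplingMatrix_le (A B : Matrix R R ℝ) :
    specNorm (couplingMatrix A B) ≤ frobNorm A * specNorm B := by
  refine specNorm_le_of_forall _ (mul_nonneg (frobNorm_nonneg A) (specNorm_nonneg B)) fun v => ?_
  set X : Matrix R R ℝ := Matrix.of fun k l => v (k, l) with hX
  have h1 : ∑ ij, (couplingMatrix A B *ᵥ v) ij ^ 2 = frobNorm (A * X * B) ^ 2 := by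
    rw [← frobNorm_transpose, frobNorm_sq, Fintype.sum_prod_type]
    refine Finset.sum_congr rfl fun i _ => Finset.sum_congr rfl fun j _ => ?_
    congr 1
    simp only [Matrix.mulVec, dotProduct, couplingMatrix, Matrix.of_apply, Fintype.sum_prod_type,
      Matrix.transpose_apply, Matrix.mul_apply, Finset.sum_mul, hX]
    rw [Finset.sum_comm]
    refine Finset.sum_congr rfl fun l _ => Finset.sum_congr rfl fun k _ => ?_
    ring
  have h2 : ∑ kl, v kl ^ 2 = frobNorm X ^ 2 := by
    rw [frobNorm_sq, Fintype.sum_prod_type]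
    rfl
  rw [h1, h2, ← mul_pow]
  refine pow_le_pow_left₀ (frobNorm_nonneg _) ?_ 2
  calc frobNorm (A * X * B) ≤ frobNorm (A * X) * specNorm B := frobNorm_mul_le_mul_specNorm _ _
    _ ≤ frobNorm A * frobNorm X * specNorm B :=
        mul_le_mul_of_nonneg_right (frobNorm_mul_le A X) (specNorm_nonneg B)
    _ = frobNorm A * specNorm B * frobNorm X := by ring

variable [Fintype Y₁] [Fintype Y₂] [DecidableEq Y₂]
  (M₁ : Matrix Y₁ (R × R) ℝ) (M₂ : Matrix Y₂ (R × R) ℝ)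
  (A B : Matrix R R ℝ)

theorem frobNorm_ringContraction_le :
    frobNorm (ringContraction M₁ M₂ A B) ≤
      specNorm M₁ * specNorm M₂ * (frobNorm A * frobNorm B) := by
  calc frobNorm (ringContraction M₁ M₂ A B)
      ≤ frobNorm (M₁ * couplingMatrix A B) * specNorm M₂ᵀ := frobNorm_mul_le_mul_specNorm _ _
    _ ≤ specNorm M₁ * frobNorm (couplingMatrix A B) * specNorm M₂ᵀ :=
        mul_le_mul_of_nonneg_right (frobNorm_mul_le_specNorm_mul _ _) (specNorm_nonneg _)
    _ = _ := by
        rw [specNorm_transpose, frobNorm_couplingMatrix]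
        ring

theorem specNorm_ringContraction_le :
    specNorm (ringContraction M₁ M₂ A B) ≤
      specNorm M₁ * specNorm M₂ * (frobNorm A * specNorm B) := by
  calc specNorm (ringContraction M₁ M₂ A B)
      ≤ specNorm (M₁ * couplingMatrix A B) * specNorm M₂ᵀ := specNorm_mul_le _ _
    _ ≤ specNorm M₁ * (frobNorm A * specNorm B) * specNorm M₂ᵀ :=
        mul_le_mul_of_nonneg_right ((specNorm_mul_le _ _).trans
          (mul_le_mul_of_nonneg_left (specNorm_couplingMatrix_le A B) (specNorm_nonneg _)))
          (specNorm_nonneg _)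
    _ = _ := by
        rw [specNorm_transpose]
        ring

variable {M₁ M₂}

theorem frobNorm_mul_le_ringContraction [DecidableEq Y₁] (h₁ : pinv M₁ * M₁ = 1)
    (h₂ : pinv M₂ * M₂ = 1) :
    frobNorm A * frobNorm B ≤
      specNorm (pinv M₁) * specNorm (pinv M₂) * frobNorm (ringContraction M₁ M₂ A B) := by
  have h : couplingMatrix A B = pinv M₁ * ringContraction M₁ M₂ A B * (pinv M₂)ᵀ := by
    have e : M₂ᵀ * (pinv M₂)ᵀ = 1 := by
      rw [← Matrix.transpose_mul, h₂, Matrix.transpose_one]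
    calc couplingMatrix A B = (pinv M₁ * M₁) * couplingMatrix A B * (M₂ᵀ * (pinv M₂)ᵀ) := by
          rw [h₁, e, Matrix.one_mul, Matrix.mul_one]
      _ = _ := by simp only [ringContraction, Matrix.mul_assoc]
  rw [← frobNorm_couplingMatrix, h]
  calc frobNorm (pinv M₁ * ringContraction M₁ M₂ A B * (pinv M₂)ᵀ)
      ≤ frobNorm (pinv M₁ * ringContraction M₁ M₂ A B) * specNorm (pinv M₂)ᵀ :=
        frobNorm_mul_le_mul_specNorm _ _
    _ ≤ specNorm (pinv M₁) * frobNorm (ringContraction M₁ M₂ A B) * specNorm (pinv M₂)ᵀ :=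
        mul_le_mul_of_nonneg_right (frobNorm_mul_le_specNorm_mul _ _) (specNorm_nonneg _)
    _ = _ := by
        rw [specNorm_transpose]
        ring

end Contraction

/-! ### Cutting the ring into regions -/

section Ring

variable {d n r : ℕ} [NeZero d]

theorem ringSegment_append (H : Cores d n r) (s L L' : ℕ) (y : Fin L → Fin n)
    (y' : Fin L' → Fin n) :
    ringSegment H s (L + L') (Fin.append y y') =
      ringSegment H s L y * ringSegment H (s + L) L' y' := by
  rw [ringSegment, List.ofFn_add, List.prod_append]
  simp [ringSegment, add_assoc]

/-- The trace of a product along the whole ring does not depend on the site it starts from. -/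
theorem trace_prod_ofFn_shift (G : Fin d → Matrix (Fin r) (Fin r) ℝ) (s : ℕ) :
    ((List.ofFn fun i : Fin d => G (Fin.ofNat d (s + i))).prod).trace =
      ((List.ofFn G).prod).trace := by
  have h : (List.ofFn fun i : Fin d => G (Fin.ofNat d (s + i))) = (List.ofFn G).rotate s := by
    refine List.ext_getElem (by simp) fun i h₁ h₂ => ?_
    rw [List.getElem_rotate]
    simp [Fin.ofNat, add_comm]
  rw [h, List.rotate_eq_drop_append_take_mod, List.prod_append, Matrix.trace_mul_comm,
    ← List.prod_append, List.take_append_drop]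

theorem tensorRing_glue (H : Cores d n r) (P : RingPartition d) (y₁ : Fin P.Lc₁ → Fin n)
    (ya : Fin P.La → Fin n) (y₂ : Fin P.Lc₂ → Fin n) (yb : Fin P.Lb → Fin n) :
    tensorRing H (P.glue y₁ ya y₂ yb) =
      (ringSegment H P.start P.Lc₁ y₁ * ringSegment H P.startA P.La ya *
        ringSegment H P.startC₂ P.Lc₂ y₂ * ringSegment H P.startB P.Lb yb).trace := by
  rw [tensorRing, ← trace_prod_ofFn_shift (fun k => H k (P.glue y₁ ya y₂ yb k)) P.start]
  simp only [RingPartition.startA, RingPartition.startC₂, RingPartition.startB]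
  rw [← ringSegment_append, add_assoc P.start P.Lc₁ P.La, ← ringSegment_append,
    add_assoc P.start (P.Lc₁ + P.La) P.Lc₂, ← ringSegment_append, ringSegment]
  congr 2
  refine List.ext_getElem (by simp [P.sum_eq]) fun i h₁ h₂ => ?_
  have hi : i < d := by simpa using h₁
  simp only [List.getElem_ofFn, RingPartition.glue]
  have e : Fin.ofNat d (P.start + i) - Fin.ofNat d P.start = ⟨i, hi⟩ := by
    rw [sub_eq_iff_eq_add]
    ext
    simp [Fin.val_add, add_comm, Fin.ofNat]
  rw [e]
  rfl

end Ring

/-! ### Projections and successive truncation -/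

section Projections

theorem transpose_eq_of_mem_rankProjections {m : Type*} [Fintype m] {r : ℕ} {Q : Matrix m m ℝ}
    (hQ : Q ∈ rankProjections m r) : Qᵀ = Q := by
  obtain ⟨X, -, rfl⟩ := hQ
  rw [Matrix.transpose_mul, Matrix.transpose_transpose]

theorem mul_self_of_mem_rankProjections {m : Type*} [Fintype m] {r : ℕ} {Q : Matrix m m ℝ}
    (hQ : Q ∈ rankProjections m r) : Q * Q = Q := by
  obtain ⟨X, hX, rfl⟩ := hQ
  rw [Matrix.mul_assoc, ← Matrix.mul_assoc Xᵀ, hX, Matrix.one_mul]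

/-- The orthogonal projection onto the row space of a matrix with `r` independent rows. -/
theorem exists_rankProjection_mul_eq {m : Type*} [Fintype m] {r : ℕ} (Y : Matrix (Fin r) m ℝ)
    (hY : LinearIndependent ℝ Y.row) : ∃ Q ∈ rankProjections m r, Y * Q = Y := by
  set y : Fin r → EuclideanSpace ℝ m := fun i => WithLp.toLp 2 (Y i) with hy
  have hli : LinearIndependent ℝ y :=
    hY.map' (WithLp.linearEquiv 2 ℝ (m → ℝ)).symm.toLinearMap (LinearEquiv.ker _)
  set S := Submodule.span ℝ (Set.range y) with hS
  have hfin : Module.finrank ℝ S = r := by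
    rw [hS, finrank_span_eq_card hli, Fintype.card_fin]
  let b : OrthonormalBasis (Fin r) ℝ S := (stdOrthonormalBasis ℝ S).reindex (finCongr hfin)
  let X : Matrix m (Fin r) ℝ := Matrix.of fun i j => (b j : EuclideanSpace ℝ m) i
  refine ⟨X * Xᵀ, ⟨X, ?_, rfl⟩, ?_⟩
  · ext j k
    have h := orthonormal_iff_ite.mp b.orthonormal j k
    rw [Submodule.coe_inner, PiLp.inner_apply] at h
    rw [Matrix.mul_apply, Matrix.one_apply, ← h]
    refine Finset.sum_congr rfl fun i _ => ?_
    simp [X, mul_comm]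
  · ext i a
    have hyS : y i ∈ S := Submodule.subset_span ⟨i, rfl⟩
    have h := congrArg (fun v : S => (v : EuclideanSpace ℝ m) a) (b.sum_repr' ⟨y i, hyS⟩)
    simp only [Submodule.coe_sum, Submodule.coe_smul, WithLp.ofLp_sum, Finset.sum_apply,
      PiLp.smul_apply, smul_eq_mul, Submodule.coe_inner] at h
    rw [← Matrix.mul_assoc, Matrix.mul_apply]
    refine Eq.trans (Finset.sum_congr rfl fun j _ => ?_) h
    rw [Matrix.mul_apply, PiLp.inner_apply]
    simp [X, hy, mul_comm]

/-- If a Kronecker product has a right inverse, then its left factor has independent rows. -/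
theorem linearIndependent_row_of_kronecker_left {a b m k : Type*} [Fintype a] [DecidableEq a]
    [Fintype b] [DecidableEq b] [Nonempty b] [Fintype m] [Fintype k] {Y₁ : Matrix a m ℝ}
    {Y₂ : Matrix b k ℝ} {Z : Matrix (m × k) (a × b) ℝ} (h : (Y₁ ⊗ₖ Y₂) * Z = 1) :
    LinearIndependent ℝ Y₁.row := by
  rw [← Matrix.vecMul_injective_iff, ← Matrix.coe_vecMulLinear, ← LinearMap.ker_eq_bot,
    LinearMap.ker_eq_bot']
  intro w hw
  have hw' : Matrix.replicateRow Unit w * Y₁ = 0 := by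
    rw [← Matrix.replicateRow_vecMul]
    ext i j
    exact congrFun hw j
  have h0 : (Matrix.replicateRow Unit w ⊗ₖ (1 : Matrix b b ℝ)) * (Y₁ ⊗ₖ Y₂) = 0 := by
    rw [← Matrix.mul_kronecker_mul, hw', Matrix.zero_kronecker]
  have h1 : Matrix.replicateRow Unit w ⊗ₖ (1 : Matrix b b ℝ) = 0 := by
    rw [← Matrix.mul_one (Matrix.replicateRow Unit w ⊗ₖ (1 : Matrix b b ℝ)), ← h,
      ← Matrix.mul_assoc, h0, Matrix.zero_mul]
  ext i
  obtain ⟨x⟩ := ‹Nonempty b›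
  simpa using congrFun (congrFun h1 ((), x)) (i, x)

/-- If a Kronecker product has a right inverse, then its right factor has independent rows. -/
theorem linearIndependent_row_of_kronecker_right {a b m k : Type*} [Fintype a] [DecidableEq a]
    [Fintype b] [DecidableEq b] [Nonempty a] [Fintype m] [Fintype k] {Y₁ : Matrix a m ℝ}
    {Y₂ : Matrix b k ℝ} {Z : Matrix (m × k) (a × b) ℝ} (h : (Y₁ ⊗ₖ Y₂) * Z = 1) :
    LinearIndependent ℝ Y₂.row := by
  rw [← Matrix.vecMul_injective_iff, ← Matrix.coe_vecMulLinear, ← LinearMap.ker_eq_bot,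
    LinearMap.ker_eq_bot']
  intro w hw
  have hw' : Matrix.replicateRow Unit w * Y₂ = 0 := by
    rw [← Matrix.replicateRow_vecMul]
    ext i j
    exact congrFun hw j
  have h0 : ((1 : Matrix a a ℝ) ⊗ₖ Matrix.replicateRow Unit w) * (Y₁ ⊗ₖ Y₂) = 0 := by
    rw [← Matrix.mul_kronecker_mul, hw', Matrix.kronecker_zero]
  have h1 : (1 : Matrix a a ℝ) ⊗ₖ Matrix.replicateRow Unit w = 0 := by
    rw [← Matrix.mul_one ((1 : Matrix a a ℝ) ⊗ₖ Matrix.replicateRow Unit w), ← h,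
      ← Matrix.mul_assoc, h0, Matrix.zero_mul]
  ext i
  obtain ⟨x⟩ := ‹Nonempty a›
  simpa using congrFun (congrFun h1 (x, ())) (x, i)

/-- Truncating `D` by two successive optimal projections `π₁`, `π₂` costs at most `√2` times the
distance from `D` to any `T` that is fixed by two competitors `ρ₁`, `ρ₂`: the two truncation
errors are orthogonal and each is at most that distance. -/
theorem frobNorm_sub_two_truncations_le {l k : Type*} [Fintype l] [Fintype k] [DecidableEq k]
    {D T : Matrix l k ℝ} {π₁ π₂ ρ₁ ρ₂ : Matrix k k ℝ}
    (hπt : π₁ᵀ = π₁) (hπ : π₁ * π₁ = π₁) (h₁t : ρ₁ᵀ = ρ₁) (h₁ : ρ₁ * ρ₁ = ρ₁)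
    (h₂t : ρ₂ᵀ = ρ₂) (h₂ : ρ₂ * ρ₂ = ρ₂) (hT₁ : T * ρ₁ = T) (hT₂ : T * ρ₂ = T)
    (hopt₁ : frobNorm (D * π₁ - D) ≤ frobNorm (D * ρ₁ - D))
    (hopt₂ : frobNorm ((D * π₂ - D) * π₁) ≤ frobNorm ((D * ρ₂ - D) * π₁)) :
    frobNorm (D - D * π₂ * π₁) ≤ Real.sqrt 2 * frobNorm (D - T) := by
  have e : ∀ ρ : Matrix k k ℝ, T * ρ = T → D - D * ρ = (D - T) * (1 - ρ) := by
    intro ρ hρ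
    rw [Matrix.sub_mul, Matrix.mul_sub, Matrix.mul_sub, hρ, Matrix.mul_one, Matrix.mul_one, sub_self,
      sub_zero]
  have b₁ : frobNorm (D * (1 - π₁)) ≤ frobNorm (D - T) := by
    rw [Matrix.mul_sub, Matrix.mul_one, frobNorm_sub_rev]
    refine hopt₁.trans ?_
    rw [frobNorm_sub_rev, e ρ₁ hT₁]
    exact frobNorm_mul_one_sub_projection_le _ h₁t h₁
  have b₂ : frobNorm ((D - D * π₂) * π₁) ≤ frobNorm (D - T) := by
    have h : frobNorm ((D - D * π₂) * π₁) = frobNorm ((D * π₂ - D) * π₁) := by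
      rw [Matrix.sub_mul, Matrix.sub_mul, frobNorm_sub_rev]
    rw [h]
    refine hopt₂.trans ?_
    rw [Matrix.sub_mul, frobNorm_sub_rev, ← Matrix.sub_mul, e ρ₂ hT₂]
    exact (frobNorm_mul_projection_le _ hπt hπ).trans
      (frobNorm_mul_one_sub_projection_le _ h₂t h₂)
  have hsplit : D - D * π₂ * π₁ = D * (1 - π₁) + (D - D * π₂) * π₁ := by
    rw [Matrix.mul_sub, Matrix.sub_mul, Matrix.mul_one]
    abel
  refine le_of_sq_le_sq ?_ (mul_nonneg (Real.sqrt_nonneg 2) (frobNorm_nonneg _))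
  rw [hsplit, frobNorm_sq_add_of_projection _ _ hπt hπ, mul_pow, Real.sq_sqrt zero_le_two, two_mul]
  exact add_le_add (pow_le_pow_left₀ (frobNorm_nonneg _) b₁ 2)
    (pow_le_pow_left₀ (frobNorm_nonneg _) b₂ 2)

theorem frobNorm_sq_eq_sum_slices {l a b : Type*} [Fintype l] [Fintype a] [Fintype b]
    (X : Matrix l (a × b) ℝ) :
    frobNorm X ^ 2 = ∑ i, frobNorm (Matrix.of fun x y => X i (x, y)) ^ 2 := by
  simp only [frobNorm_sq, Fintype.sum_prod_type, Matrix.of_apply]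

/-- A bound between the slices of two 3-tensors is a bound between the tensors. -/
theorem frobNorm_le_of_slices {l a b a' b' : Type*} [Fintype l] [Fintype a] [Fintype b]
    [Fintype a'] [Fintype b'] {X : Matrix l (a × b) ℝ} {W : Matrix l (a' × b') ℝ} {c : ℝ}
    (hc : 0 ≤ c)
    (h : ∀ i, frobNorm (Matrix.of fun x y => X i (x, y)) ≤
      c * frobNorm (Matrix.of fun x y => W i (x, y))) :
    frobNorm X ≤ c * frobNorm W := by
  refine le_of_sq_le_sq ?_ (mul_nonneg hc (frobNorm_nonneg _))
  rw [mul_pow, frobNorm_sq_eq_sum_slices, frobNorm_sq_eq_sum_slices, Finset.mul_sum]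
  refine Finset.sum_le_sum fun i _ => ?_
  rw [← mul_pow]
  exact pow_le_pow_left₀ (frobNorm_nonneg _) (h i) 2

end Projections

/-! ### The tensors of the recovery procedure -/

section Lifts

variable {d n : ℕ} {P : RingPartition d}

theorem onC₁_transpose {Q : Matrix (Fin P.Lc₁ → Fin n) (Fin P.Lc₁ → Fin n) ℝ} (hQ : Qᵀ = Q) :
    (onC₁ P Q)ᵀ = onC₁ P Q := by
  rw [onC₁, ← Matrix.kroneckerMap_transpose, hQ, Matrix.transpose_one]

theorem onC₁_mul_self {Q : Matrix (Fin P.Lc₁ → Fin n) (Fin P.Lc₁ → Fin n) ℝ} (hQ : Q * Q = Q) :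
    onC₁ P Q * onC₁ P Q = onC₁ P Q := by
  rw [onC₁, ← Matrix.mul_kronecker_mul, hQ, Matrix.one_mul]

theorem onC₂_transpose {Q : Matrix (Fin P.Lc₂ → Fin n) (Fin P.Lc₂ → Fin n) ℝ} (hQ : Qᵀ = Q) :
    (onC₂ P Q)ᵀ = onC₂ P Q := by
  rw [onC₂, ← Matrix.kroneckerMap_transpose, hQ, Matrix.transpose_one]

theorem onC₂_mul_self {Q : Matrix (Fin P.Lc₂ → Fin n) (Fin P.Lc₂ → Fin n) ℝ} (hQ : Q * Q = Q) :
    onC₂ P Q * onC₂ P Q = onC₂ P Q := by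
  rw [onC₂, ← Matrix.mul_kronecker_mul, hQ, Matrix.one_mul]

end Lifts

section Recovery

variable {d n r : ℕ} [NeZero d] (H : Cores d n r) (P : RingPartition d)

theorem hatT_eq_ringContraction (zb : Fin P.Lb → Fin n) (ya : Fin P.La → Fin n)
    (y₁ : Fin P.Lc₁ → Fin n) (y₂ : Fin P.Lc₂ → Fin n) :
    hatT (tensorRing H) P zb ya y₁ y₂ =
      ringContraction (segmentMatrix H P.start P.Lc₁) (segmentMatrix H P.startC₂ P.Lc₂)
        (ringSegment H P.startA P.La ya) (B₂ H P zb) y₁ y₂ := by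
  rw [hatT, tensorRing_glue, ringContraction_apply_eq_trace]
  rfl

theorem frozenMatrix_eq_ringContraction (za : Fin P.La → Fin n) (zb : Fin P.Lb → Fin n) :
    frozenMatrix (tensorRing H) P za zb =
      ringContraction (segmentMatrix H P.start P.Lc₁) (segmentMatrix H P.startC₂ P.Lc₂)
        (ringSegment H P.startA P.La za) (B₂ H P zb) := by
  ext y₁ y₂
  exact hatT_eq_ringContraction H P zb za y₁ y₂

/-- Multiplication by `H̃^{c₁} ⊗ H̃^{c₂}` closes the ring with `p qᵀ` in region `b`. -/
theorem mul_kronecker_tildeH_apply {l : Type*} (W : Matrix l (Fin r × Fin r) ℝ) (p q : Fin r → ℝ)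
    (i : l) (y₁ : Fin P.Lc₁ → Fin n) (y₂ : Fin P.Lc₂ → Fin n) :
    (W * (tildeHc₁ H P q ⊗ₖ tildeHc₂ H P p)) i (y₁, y₂) =
      ringContraction (segmentMatrix H P.start P.Lc₁) (segmentMatrix H P.startC₂ P.Lc₂)
        (Matrix.of fun j k => W i (j, k)) (Matrix.vecMulVec p q) y₁ y₂ := by
  rw [ringContraction_apply_eq_trace, Matrix.mul_apply, Fintype.sum_prod_type]
  simp only [Matrix.kroneckerMap_apply, tildeHc₁, tildeHc₂, Matrix.of_apply, segmentMatrix]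
  set S₁ := ringSegment H P.start P.Lc₁ y₁
  set S₂ := ringSegment H P.startC₂ P.Lc₂ y₂
  set A : Matrix (Fin r) (Fin r) ℝ := Matrix.of fun j k => W i (j, k)
  change ∑ j, ∑ k, A j k * ((q ᵥ* S₁) j * (S₂ *ᵥ p) k) = (S₁ * A * S₂ * Matrix.vecMulVec p q).trace
  rw [Matrix.mul_vecMulVec, Matrix.trace_vecMulVec, ← Matrix.mulVec_mulVec,
    ← Matrix.mulVec_mulVec, dotProduct_comm, Matrix.dotProduct_mulVec, dotProduct]
  refine Finset.sum_congr rfl fun j _ => ?_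
  rw [Matrix.mulVec, dotProduct, Finset.mul_sum]
  refine Finset.sum_congr rfl fun k _ => ?_
  ring

/-- The two reshapings of `T̂` see the same error of a projection of the index in `c₁`. -/
theorem frobNorm_hatTa_mul_onC₁_sub (f : (Fin d → Fin n) → ℝ) (zb : Fin P.Lb → Fin n)
    (Q : Matrix (Fin P.Lc₁ → Fin n) (Fin P.Lc₁ → Fin n) ℝ) :
    frobNorm (hatTa f P zb * onC₁ P Q - hatTa f P zb) =
      frobNorm (hatTc₁ f P zb * Q - hatTc₁ f P zb) := by
  have e : ∀ ya y₁ y₂, (hatTa f P zb * onC₁ P Q) ya (y₁, y₂) = (hatTc₁ f P zb * Q) (y₂, ya) y₁ := by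
    intro ya y₁ y₂
    simp only [Matrix.mul_apply, Fintype.sum_prod_type, onC₁, Matrix.kroneckerMap_apply,
      Matrix.one_apply, hatTa, hatTc₁, Matrix.of_apply, mul_ite, mul_one, mul_zero,
      Finset.sum_ite_eq', Finset.mem_univ, if_true]
  unfold frobNorm
  congr 1
  simp only [Fintype.sum_prod_type, Matrix.sub_apply, e]
  simp only [hatTa, hatTc₁, Matrix.of_apply]
  rw [Finset.sum_comm (s := (Finset.univ : Finset (Fin P.Lc₂ → Fin n)))]
  refine Finset.sum_congr rfl fun ya _ => ?_
  rw [Finset.sum_comm]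

end Recovery

/-! ### The recovery error -/

section Error

variable {d n r : ℕ} [NeZero d] {H : Cores d n r} {P : RingPartition d}

/-- Approximate Markovianity bounds the matrix of region `b` by its best rank-one approximation:
freezing region `a` at a nonzero slice gives a matrix whose Frobenius norm is at least a multiple
of `‖B²‖_F` and whose spectral norm is at most a multiple of the spectral norm of `B²`. -/
theorem frobNorm_B₂_sq_le {α κ : ℝ} {zb : Fin P.Lb → Fin n} {p q : Fin r → ℝ}
    (hα : 0 ≤ α)
    (hM₁ : pinv (segmentMatrix H P.start P.Lc₁) * segmentMatrix H P.start P.Lc₁ = 1)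
    (hM₂ : pinv (segmentMatrix H P.startC₂ P.Lc₂) * segmentMatrix H P.startC₂ P.Lc₂ = 1)
    (hκ₁ : condNumber (segmentMatrix H P.start P.Lc₁) ≤ κ)
    (hκ₂ : condNumber (segmentMatrix H P.startC₂ P.Lc₂) ≤ κ) (hκ : 0 ≤ κ)
    (hMarkov : ∀ za, α * frobNorm (frozenMatrix (tensorRing H) P za zb) ^ 2 ≤
      specNorm (frozenMatrix (tensorRing H) P za zb) ^ 2)
    (hT : hatT (tensorRing H) P zb ≠ 0) (hpq : IsBestRankOne (B₂ H P zb) p q) :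
    α * frobNorm (B₂ H P zb) ^ 2 ≤ κ ^ 4 * ((∑ i, p i ^ 2) * ∑ j, q j ^ 2) := by
  obtain ⟨za, hza⟩ : ∃ za, ringSegment H P.startA P.La za ≠ 0 := by
    by_contra! h
    apply hT
    ext ya y₁ y₂
    rw [hatT_eq_ringContraction, ringContraction_apply_eq_trace, h ya]
    simp
  have hF := hMarkov za
  rw [frozenMatrix_eq_ringContraction] at hF
  have hlow := frobNorm_mul_le_ringContraction (ringSegment H P.startA P.La za) (B₂ H P zb) hM₁ hM₂
  have hup := specNorm_ringContraction_le (segmentMatrix H P.start P.Lc₁)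
    (segmentMatrix H P.startC₂ P.Lc₂) (ringSegment H P.startA P.La za) (B₂ H P zb)
  have hB := hpq.specNorm_sq_le
  have hcc : condNumber (segmentMatrix H P.start P.Lc₁) *
      condNumber (segmentMatrix H P.startC₂ P.Lc₂) ≤ κ * κ :=
    mul_le_mul hκ₁ hκ₂ (mul_nonneg (specNorm_nonneg _) (specNorm_nonneg _)) hκ
  unfold condNumber at hcc
  set M₁ := segmentMatrix H P.start P.Lc₁
  set M₂ := segmentMatrix H P.startC₂ P.Lc₂
  set A := ringSegment H P.startA P.La za
  set B := B₂ H P zb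
  set F := ringContraction M₁ M₂ A B
  set s := (∑ i, p i ^ 2) * ∑ j, q j ^ 2
  have hA : 0 < frobNorm A ^ 2 :=
    pow_pos (lt_of_le_of_ne (frobNorm_nonneg A) fun h => hza (frobNorm_eq_zero.mp h.symm)) 2
  have hm := specNorm_nonneg M₁
  have hm2 := specNorm_nonneg M₂
  have hn := specNorm_nonneg (pinv M₁)
  have hn2 := specNorm_nonneg (pinv M₂)
  have hlow2 := pow_le_pow_left₀ (mul_nonneg (frobNorm_nonneg A) (frobNorm_nonneg B)) hlow 2
  have hup2 := pow_le_pow_left₀ (specNorm_nonneg F) hup 2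
  have h : frobNorm A ^ 2 * (α * frobNorm B ^ 2) ≤ frobNorm A ^ 2 * (κ ^ 4 * s) := by
    calc frobNorm A ^ 2 * (α * frobNorm B ^ 2) = α * (frobNorm A * frobNorm B) ^ 2 := by ring
      _ ≤ α * (specNorm (pinv M₁) * specNorm (pinv M₂) * frobNorm F) ^ 2 :=
          mul_le_mul_of_nonneg_left hlow2 hα
      _ = (specNorm (pinv M₁) * specNorm (pinv M₂)) ^ 2 * (α * frobNorm F ^ 2) := by ring
      _ ≤ (specNorm (pinv M₁) * specNorm (pinv M₂)) ^ 2 *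
            (specNorm M₁ * specNorm M₂ * (frobNorm A * specNorm B)) ^ 2 :=
          mul_le_mul_of_nonneg_left (hF.trans hup2) (sq_nonneg _)
      _ = (specNorm M₁ * specNorm (pinv M₁) * (specNorm M₂ * specNorm (pinv M₂))) ^ 2 *
            (frobNorm A ^ 2 * specNorm B ^ 2) := by ring
      _ ≤ (κ * κ) ^ 2 * (frobNorm A ^ 2 * s) := by gcongr
      _ = frobNorm A ^ 2 * (κ ^ 4 * s) := by ring
  exact le_of_mul_le_mul_left h hA

/-- The recovery error in terms of the rank-one error of the matrix of region `b`: with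
`G = H̃^{c₁} ⊗ H̃^{c₂}`, which has the right inverse `G†`, the error is `(Hᵃ G - T̂̂) G†`. -/
theorem frobNorm_segA_sub_recoveredA_le {zb : Fin P.Lb → Fin n} {p q : Fin r → ℝ}
    {P₁ : Matrix (Fin P.Lc₁ → Fin n) (Fin P.Lc₁ → Fin n) ℝ}
    {P₂ : Matrix (Fin P.Lc₂ → Fin n) (Fin P.Lc₂ → Fin n) ℝ} (hr : 0 < r)
    (hM₁ : pinv (segmentMatrix H P.start P.Lc₁) * segmentMatrix H P.start P.Lc₁ = 1)
    (hM₂ : pinv (segmentMatrix H P.startC₂ P.Lc₂) * segmentMatrix H P.startC₂ P.Lc₂ = 1)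
    (hpq : 0 < frobNorm (Matrix.vecMulVec p q))
    (hP₁ : IsOptimalP₁ (tensorRing H) P zb r P₁)
    (hP₂ : IsOptimalP₂ (tensorRing H) P zb r P₁ P₂) :
    frobNorm (segA H P - recoveredA H P zb p q P₁ P₂) ≤
      (1 + Real.sqrt 2) * (condNumber (segmentMatrix H P.start P.Lc₁) *
        condNumber (segmentMatrix H P.startC₂ P.Lc₂)) * frobNorm (segA H P) *
        (frobNorm (B₂ H P zb - Matrix.vecMulVec p q) / frobNorm (Matrix.vecMulVec p q)) := by
  have : Nonempty (Fin r) := ⟨⟨0, hr⟩⟩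
  -- The slices of `W G` are ring contractions with `p qᵀ` in region `b`.
  have hslice := fun {l : Type} (W : Matrix l (Fin r × Fin r) ℝ) (i : l) =>
    Matrix.ext fun y₁ y₂ => mul_kronecker_tildeH_apply H P W p q i y₁ y₂
  set G := tildeHc₁ H P q ⊗ₖ tildeHc₂ H P p with hGdef
  set D := hatTa (tensorRing H) P zb with hDdef
  unfold condNumber
  have hD : ∀ ya y₁ y₂, D ya (y₁, y₂) = ringContraction (segmentMatrix H P.start P.Lc₁)
      (segmentMatrix H P.startC₂ P.Lc₂) (ringSegment H P.startA P.La ya) (B₂ H P zb) y₁ y₂ :=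
    hatT_eq_ringContraction H P zb
  set M₁ := segmentMatrix H P.start P.Lc₁
  set M₂ := segmentMatrix H P.startC₂ P.Lc₂
  set B := B₂ H P zb
  set σ := frobNorm (Matrix.vecMulVec p q) with hσ
  set c := specNorm (pinv M₁) * specNorm (pinv M₂) / σ with hc
  have hn : 0 ≤ specNorm (pinv M₁) := specNorm_nonneg _
  have hn2 : 0 ≤ specNorm (pinv M₂) := specNorm_nonneg _
  have hm : 0 ≤ specNorm M₁ := specNorm_nonneg _
  have hm2 : 0 ≤ specNorm M₂ := specNorm_nonneg _
  have hc0 : 0 ≤ c := by positivity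
  -- As the segments of `c₁` and `c₂` are well conditioned, `G` is bounded below.
  have hG : ∀ {l : Type} [Fintype l] (W : Matrix l (Fin r × Fin r) ℝ),
      frobNorm W ≤ c * frobNorm (W * G) := by
    intro l _ W
    refine frobNorm_le_of_slices hc0 fun i => ?_
    have h := frobNorm_mul_le_ringContraction (Matrix.of fun j k => W i (j, k))
      (Matrix.vecMulVec p q) hM₁ hM₂
    rw [← hslice W i] at h
    rw [hc, div_mul_eq_mul_div, le_div_iff₀ hpq]
    exact h
  have hGG : G * pinv G = 1 := mul_pinv_of_antilipschitz hG
  -- The distance from `T̂` to the tensor with `p qᵀ` in region `b`.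
  have hdist : frobNorm (D - segA H P * G) ≤
      specNorm M₁ * specNorm M₂ * frobNorm (B - Matrix.vecMulVec p q) * frobNorm (segA H P) := by
    refine frobNorm_le_of_slices (mul_nonneg (by positivity) (frobNorm_nonneg _)) fun ya => ?_
    have e : (Matrix.of fun y₁ y₂ => (D - segA H P * G) ya (y₁, y₂)) =
        ringContraction M₁ M₂ (ringSegment H P.startA P.La ya) (B - Matrix.vecMulVec p q) := by
      rw [ringContraction_sub_right]
      ext y₁ y₂
      rw [Matrix.of_apply, Matrix.sub_apply, Matrix.sub_apply, hD]
      congr 1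
      exact mul_kronecker_tildeH_apply H P (segA H P) p q ya y₁ y₂
    rw [e]
    refine (frobNorm_ringContraction_le M₁ M₂ _ _).trans (le_of_eq ?_)
    have e2 : (Matrix.of fun j k => segA H P ya (j, k)) = ringSegment H P.startA P.La ya := rfl
    rw [e2]
    ring
  obtain ⟨Q₁, hQ₁, hYQ₁⟩ := exists_rankProjection_mul_eq (tildeHc₁ H P q)
    (linearIndependent_row_of_kronecker_left hGG)
  obtain ⟨Q₂, hQ₂, hYQ₂⟩ := exists_rankProjection_mul_eq (tildeHc₂ H P p)
    (linearIndependent_row_of_kronecker_right hGG)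
  have hproj : frobNorm (D - projT (tensorRing H) P zb P₁ P₂) ≤
      Real.sqrt 2 * frobNorm (D - segA H P * G) := by
    refine frobNorm_sub_two_truncations_le (ρ₁ := onC₁ P Q₁) (ρ₂ := onC₂ P Q₂)
      (onC₁_transpose (transpose_eq_of_mem_rankProjections hP₁.1))
      (onC₁_mul_self (mul_self_of_mem_rankProjections hP₁.1))
      (onC₁_transpose (transpose_eq_of_mem_rankProjections hQ₁))
      (onC₁_mul_self (mul_self_of_mem_rankProjections hQ₁))
      (onC₂_transpose (transpose_eq_of_mem_rankProjections hQ₂))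
      (onC₂_mul_self (mul_self_of_mem_rankProjections hQ₂)) ?_ ?_ ?_ (hP₂.2 Q₂ hQ₂)
    · rw [Matrix.mul_assoc, hGdef, onC₁, ← Matrix.mul_kronecker_mul, hYQ₁, Matrix.mul_one]
    · rw [Matrix.mul_assoc, hGdef, onC₂, ← Matrix.mul_kronecker_mul, hYQ₂, Matrix.mul_one]
    · rw [frobNorm_hatTa_mul_onC₁_sub, frobNorm_hatTa_mul_onC₁_sub]
      exact hP₁.2 Q₁ hQ₁
  have hfull : frobNorm (segA H P * G - projT (tensorRing H) P zb P₁ P₂) ≤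
      (1 + Real.sqrt 2) * frobNorm (D - segA H P * G) := by
    calc frobNorm (segA H P * G - projT (tensorRing H) P zb P₁ P₂)
        = frobNorm ((segA H P * G - D) + (D - projT (tensorRing H) P zb P₁ P₂)) := by
          rw [sub_add_sub_cancel]
      _ ≤ frobNorm (segA H P * G - D) + frobNorm (D - projT (tensorRing H) P zb P₁ P₂) :=
          frobNorm_add_le _ _
      _ ≤ frobNorm (D - segA H P * G) + Real.sqrt 2 * frobNorm (D - segA H P * G) := by
          rw [frobNorm_sub_rev]
          exact add_le_add_right hproj _
      _ = _ := by ring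
  have hrec : segA H P - recoveredA H P zb p q P₁ P₂ =
      (segA H P * G - projT (tensorRing H) P zb P₁ P₂) * pinv G := by
    rw [Matrix.sub_mul, Matrix.mul_assoc, hGG, Matrix.mul_one]
    rfl
  rw [hrec]
  calc frobNorm ((segA H P * G - projT (tensorRing H) P zb P₁ P₂) * pinv G)
      ≤ c * frobNorm (segA H P * G - projT (tensorRing H) P zb P₁ P₂) :=
        frobNorm_mul_pinv_le hc0 hG _
    _ ≤ c * ((1 + Real.sqrt 2) * (specNorm M₁ * specNorm M₂ *
          frobNorm (B - Matrix.vecMulVec p q) * frobNorm (segA H P))) :=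
        mul_le_mul_of_nonneg_left
          (hfull.trans (mul_le_mul_of_nonneg_left hdist (by positivity))) hc0
    _ = _ := by
        rw [hc]
        ring

/-- The bound `(1 + √2)² κ⁴ (κ⁴ / α - 1)` for the recovery error. It does not involve the bond
dimension `r` and needs no smallness of `κ` or `1 - α`. -/
theorem recovery_error_le {L₀ Lbuf : ℕ} {α κ : ℝ} {zb : Fin P.Lb → Fin n} {p q : Fin r → ℝ}
    {P₁ : Matrix (Fin P.Lc₁ → Fin n) (Fin P.Lc₁ → Fin n) ℝ}
    {P₂ : Matrix (Fin P.Lc₂ → Fin n) (Fin P.Lc₂ → Fin n) ℝ}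
    (hα : 0 < α) (hLa : max L₀ Lbuf ≤ P.La) (hLb : max L₀ Lbuf ≤ P.Lb)
    (hLc₁ : max L₀ Lbuf ≤ P.Lc₁) (hLc₂ : max L₀ Lbuf ≤ P.Lc₂)
    (hH : NondegenerateSegments H L₀ κ) (hMarkov : ApproxMarkov (tensorRing H) P Lbuf α)
    (hT : hatT (tensorRing H) P zb ≠ 0) (hpq : IsBestRankOne (B₂ H P zb) p q)
    (hP₁ : IsOptimalP₁ (tensorRing H) P zb r P₁)
    (hP₂ : IsOptimalP₂ (tensorRing H) P zb r P₁ P₂) :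
    0 < r ∧ 1 ≤ κ ∧
      frobNorm (segA H P - recoveredA H P zb p q P₁ P₂) ^ 2 / frobNorm (segA H P) ^ 2 ≤
        (1 + Real.sqrt 2) ^ 2 * κ ^ 4 * (κ ^ 4 / α - 1) := by
  have hr : 0 < r := by
    rcases Nat.eq_zero_or_pos r with rfl | h
    · refine absurd ?_ hT
      ext ya y₁ y₂
      rw [hatT_eq_ringContraction, ringContraction_apply_eq_trace]
      simp [Matrix.trace]
    · exact h
  have hsum := P.sum_eq
  obtain ⟨hrk₁, hκ₁⟩ := hH P.start P.Lc₁ ((le_max_left _ _).trans hLc₁) (by omega)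
  obtain ⟨hrk₂, hκ₂⟩ := hH P.startC₂ P.Lc₂ ((le_max_left _ _).trans hLc₂) (by omega)
  have hcard : Fintype.card (Fin r × Fin r) = r ^ 2 := by simp [sq]
  have hM₁ := pinv_mul_of_rank_eq_card (hrk₁.trans hcard.symm)
  have hM₂ := pinv_mul_of_rank_eq_card (hrk₂.trans hcard.symm)
  have hne : segmentMatrix H P.start P.Lc₁ ≠ 0 := by
    intro h
    rw [h, Matrix.rank_zero] at hrk₁
    exact (pow_pos hr 2).ne hrk₁
  have hκ1 : 1 ≤ κ := (one_le_condNumber hne).trans hκ₁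
  have hκ0 : 0 ≤ κ := zero_le_one.trans hκ1
  have hB := frobNorm_B₂_sq_le hα.le hM₁ hM₂ hκ₁ hκ₂ hκ0
    (fun za => hMarkov ((le_max_right _ _).trans hLa) ((le_max_right _ _).trans hLb) za zb) hT hpq
  rw [← frobNorm_vecMulVec_sq] at hB
  have hres := hpq.residual_sq
  rw [← frobNorm_vecMulVec_sq] at hres
  have hBne : 0 < frobNorm (B₂ H P zb) := by
    refine lt_of_le_of_ne (frobNorm_nonneg _) fun h => hT ?_
    ext ya y₁ y₂
    rw [hatT_eq_ringContraction, ringContraction_apply_eq_trace, frobNorm_eq_zero.mp h.symm]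
    simp
  have hσ2 : 0 < frobNorm (Matrix.vecMulVec p q) ^ 2 := by
    have h : 0 < α * frobNorm (B₂ H P zb) ^ 2 := by positivity
    exact pos_of_mul_pos_right (h.trans_le hB) (by positivity)
  have hσ : 0 < frobNorm (Matrix.vecMulVec p q) :=
    lt_of_le_of_ne (frobNorm_nonneg _) fun h => by simp [← h] at hσ2
  have hmain := frobNorm_segA_sub_recoveredA_le hr hM₁ hM₂ hσ hP₁ hP₂
  have hsegA : 0 < frobNorm (segA H P) := by
    refine lt_of_le_of_ne (frobNorm_nonneg _) fun h => hT ?_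
    have h0 := frobNorm_eq_zero.mp h.symm
    ext ya y₁ y₂
    have hya : ringSegment H P.startA P.La ya = 0 := by
      ext j k
      exact congrFun (congrFun h0 ya) (j, k)
    rw [hatT_eq_ringContraction, ringContraction_apply_eq_trace, hya]
    simp
  refine ⟨hr, hκ1, ?_⟩
  have hcc : condNumber (segmentMatrix H P.start P.Lc₁) *
      condNumber (segmentMatrix H P.startC₂ P.Lc₂) ≤ κ * κ :=
    mul_le_mul hκ₁ hκ₂ (mul_nonneg (specNorm_nonneg _) (specNorm_nonneg _)) hκ0
  set σ := frobNorm (Matrix.vecMulVec p q)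
  set ρ := frobNorm (B₂ H P zb - Matrix.vecMulVec p q)
  have hρ0 : 0 ≤ ρ := frobNorm_nonneg _
  have hratio : (ρ / σ) ^ 2 ≤ κ ^ 4 / α - 1 := by
    rw [div_pow, div_le_iff₀ hσ2, hres, sub_mul, one_mul, div_mul_eq_mul_div]
    exact sub_le_sub_right ((le_div_iff₀' hα).mpr hB) _
  rw [div_le_iff₀ (by positivity)]
  calc frobNorm (segA H P - recoveredA H P zb p q P₁ P₂) ^ 2
      ≤ ((1 + Real.sqrt 2) * (κ * κ) * frobNorm (segA H P) * (ρ / σ)) ^ 2 :=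
        pow_le_pow_left₀ (frobNorm_nonneg _) (hmain.trans (by gcongr)) 2
    _ = (1 + Real.sqrt 2) ^ 2 * κ ^ 4 * (ρ / σ) ^ 2 * frobNorm (segA H P) ^ 2 := by ring
    _ ≤ _ := by gcongr

/-- With `x = α / κ⁴` the left side is `(1 - x) / x`, and
`1 / κ⁴ - 2 √r √(1 - x) ≤ 1 - √(1 - x) ≤ x`. -/
theorem div_sub_one_le_of_pos {α κ : ℝ} {r : ℕ} (hα : 0 < α) (hα1 : α ≤ 1) (hκ : 1 ≤ κ)
    (hr : 0 < r) (hpos : 0 < 1 / κ ^ 4 - 2 * Real.sqrt r * Real.sqrt (1 - α / κ ^ 4)) :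
    κ ^ 4 / α - 1 ≤
      (1 - α / κ ^ 4) / (1 / κ ^ 4 - 2 * Real.sqrt r * Real.sqrt (1 - α / κ ^ 4)) := by
  have hK : 1 ≤ κ ^ 4 := one_le_pow₀ hκ
  have hK0 : 0 < κ ^ 4 := by positivity
  set x := α / κ ^ 4 with hx
  have hx0 : 0 < x := by positivity
  have hx1 : x ≤ 1 := (div_le_one hK0).mpr (hα1.trans hK)
  have hKinv : 1 / κ ^ 4 ≤ 1 := (div_le_one hK0).mpr hK
  have hsr : 1 ≤ Real.sqrt r := Real.one_le_sqrt.mpr (by exact_mod_cast hr)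
  have hs : 1 - x ≤ Real.sqrt (1 - x) := by
    refine Real.le_sqrt_of_sq_le ?_
    nlinarith
  have hden : 1 / κ ^ 4 - 2 * Real.sqrt r * Real.sqrt (1 - x) ≤ x := by
    nlinarith [Real.sqrt_nonneg (1 - x)]
  have e : κ ^ 4 / α - 1 = (1 - x) / x := by
    rw [hx]
    field_simp
  rw [e]
  exact div_le_div_of_nonneg_left (by linarith) hpos hden

end Error

end TRStability

open TRStability in
theorem proposition2 :
    (∀ (d n r : ℕ) [NeZero d] (H : Cores d n r) (P : RingPartition d) (L₀ Lbuf : ℕ) (α κ : ℝ)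
        (zb : Fin P.Lb → Fin n) (p q : Fin r → ℝ)
        (P₁ : Matrix (Fin P.Lc₁ → Fin n) (Fin P.Lc₁ → Fin n) ℝ)
        (P₂ : Matrix (Fin P.Lc₂ → Fin n) (Fin P.Lc₂ → Fin n) ℝ),
      0 < α → α ≤ 1 →
      max L₀ Lbuf ≤ P.La → max L₀ Lbuf ≤ P.Lb → max L₀ Lbuf ≤ P.Lc₁ → max L₀ Lbuf ≤ P.Lc₂ →
      NondegenerateSegments H L₀ κ →
      ApproxMarkov (tensorRing H) P Lbuf α →
      hatT (tensorRing H) P zb ≠ 0 →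
      IsBestRankOne (B₂ H P zb) p q →
      IsOptimalP₁ (tensorRing H) P zb r P₁ →
      IsOptimalP₂ (tensorRing H) P zb r P₁ P₂ →
      0 < 1 / κ ^ 4 - 2 * Real.sqrt r * Real.sqrt (1 - α / κ ^ 4) →
      frobNorm (segA H P - recoveredA H P zb p q P₁ P₂) ^ 2 / frobNorm (segA H P) ^ 2 ≤
        (1 + Real.sqrt 2) ^ 2 * κ ^ 4 * (1 - α / κ ^ 4) /
          (1 / κ ^ 4 - 2 * Real.sqrt r * Real.sqrt (1 - α / κ ^ 4))) ∧
    (∃ C : ℝ, 0 < C ∧ ∀ r : ℕ, ∃ ε : ℝ, 0 < ε ∧ ∀ δα δκ : ℝ,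
      0 ≤ δα → δα ≤ ε → 0 ≤ δκ → δκ ≤ ε →
      ∀ (d n : ℕ) [NeZero d] (H : Cores d n r) (P : RingPartition d) (L₀ Lbuf : ℕ)
        (zb : Fin P.Lb → Fin n) (p q : Fin r → ℝ)
        (P₁ : Matrix (Fin P.Lc₁ → Fin n) (Fin P.Lc₁ → Fin n) ℝ)
        (P₂ : Matrix (Fin P.Lc₂ → Fin n) (Fin P.Lc₂ → Fin n) ℝ),
      max L₀ Lbuf ≤ P.La → max L₀ Lbuf ≤ P.Lb → max L₀ Lbuf ≤ P.Lc₁ → max L₀ Lbuf ≤ P.Lc₂ →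
      NondegenerateSegments H L₀ (1 + δκ) →
      ApproxMarkov (tensorRing H) P Lbuf (1 - δα) →
      hatT (tensorRing H) P zb ≠ 0 →
      IsBestRankOne (B₂ H P zb) p q →
      IsOptimalP₁ (tensorRing H) P zb r P₁ →
      IsOptimalP₂ (tensorRing H) P zb r P₁ P₂ →
      frobNorm (segA H P - recoveredA H P zb p q P₁ P₂) ^ 2 / frobNorm (segA H P) ^ 2 ≤
        C * (δα + 4 * δκ)) := by
  refine ⟨?_, 36, by norm_num, fun r => ⟨1 / 10, by norm_num, ?_⟩⟩
  · intro d n r _ H P L₀ Lbuf α κ zb p q P₁ P₂ hα hα1 hLa hLb hLc₁ hLc₂ hH hM hT hpq hP₁ hP₂ hpos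
    obtain ⟨hr, hκ, h⟩ := recovery_error_le hα hLa hLb hLc₁ hLc₂ hH hM hT hpq hP₁ hP₂
    refine h.trans ?_
    rw [mul_div_assoc]
    exact mul_le_mul_of_nonneg_left (div_sub_one_le_of_pos hα hα1 hκ hr hpos) (by positivity)
  · intro δα δκ hα0 hα1 hκ0 hκ1 d n _ H P L₀ Lbuf zb p q P₁ P₂ hLa hLb hLc₁ hLc₂ hH hM hT hpq
      hP₁ hP₂
    have hα : 0 < 1 - δα := by linarith
    obtain ⟨-, -, h⟩ := recovery_error_le hα hLa hLb hLc₁ hLc₂ hH hM hT hpq hP₁ hP₂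
    refine h.trans ?_
    have hs : (1 + Real.sqrt 2) ^ 2 ≤ 6 := by
      nlinarith [Real.sq_sqrt (zero_le_two : (0 : ℝ) ≤ 2), sq_nonneg (Real.sqrt 2 - 3 / 2)]
    have hK : (1 + δκ) ^ 4 - 1 ≤ 2 * (4 * δκ) := by
      nlinarith [mul_nonneg hκ0 hκ0, mul_nonneg (mul_nonneg hκ0 hκ0) hκ0]
    have hK2 : (1 + δκ) ^ 4 ≤ 2 := by linarith
    have hx : (1 + δκ) ^ 4 / (1 - δα) - 1 ≤ 3 * (δα + 4 * δκ) := by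
      rw [sub_le_iff_le_add, div_le_iff₀ hα]
      nlinarith [mul_nonneg hα0 hκ0]
    have h0 : 0 ≤ δα + 4 * δκ := by linarith
    calc (1 + Real.sqrt 2) ^ 2 * (1 + δκ) ^ 4 * ((1 + δκ) ^ 4 / (1 - δα) - 1)
        ≤ (1 + Real.sqrt 2) ^ 2 * (1 + δκ) ^ 4 * (3 * (δα + 4 * δκ)) :=
          mul_le_mul_of_nonneg_left hx (by positivity)
      _ ≤ 6 * 2 * (3 * (δα + 4 * δκ)) := by gcongr
      _ = 36 * (δα + 4 * δκ) := by ring
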